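/- **Theorem (perfect parallel repetition for the Khot–Vishnoi game).** Let $m\ge 0$, $n=2^m$ and $\eta\in(0,1/2)$. Index the $n$ positions of a bit string by $j\in\{0,1\}^m$ and let $H_n=\{h\in\{0,1\}^n:\exists a\in\{0,1\}^m\ \forall j,\ h_j=a\cdot j \bmod 2\}$ be the Hadamard code. In the Khot–Vishnoi game $\mathrm{KV}_{n,\eta}$ a referee draws $x\in\{0,1\}^n$ uniformly and, independently, $z\in\{0,1\}^n$ with independent bits equal to $1$ with probability $\eta$. Alice is given the orbit $x+H_n$ and Bob the orbit $x+z+H_n$. They answer with $a,b\in\{0,1\}^n$ and win if and only if $a\in x+H_n$, $b\in x+z+H_n$ and $a+b=z$ (addition mod $2$). Let $S_L(n,\eta)$ be the local bound of this game, i.e. the supremum of the winning probability over all local behaviors $P(a,b|u,v)=\sum_\lambda\mu(\lambda)P_A(a|u,\lambda)P_B(b|v,\lambda)$, where $\lambda$ ranges over a finite set, $\mu$ is a probability distribution on it, and $P_A(\cdot|u,\lambda)$, $P_B(\cdot|v,\lambda)$ are probability distributions. For $k\ge 0$ let $S_L^{\otimes k}(n,\eta)$ be the local bound of the $k$-repetition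 of the game: $k$ pairs of inputs are drawn independently, Alice answers all of her $k$ inputs jointly, Bob likewise, and the score is the product of the $k$ individual scores. Then: 1. for all $m\ge 0$, $n=2^m$, $\eta\in(0,1/2)$ and $k\ge 0$, $$S_L(n,\eta)\le n^{-\eta/(1-\eta)},\qquad S_L^{\otimes k}(n,\eta)\le n^{-k\eta/(1-\eta)};$$ 2. with $\eta_n=\frac12-\frac1{\log_2 n}$ ($n=2^m\ge 8$) these bounds are asymptotically attained: for every fixed $k\ge 0$, $$\lim_{n\to\infty}\frac{S_L(n,\eta_n)}{n^{-\eta_n/(1-\eta_n)}}=1,\qquad \lim_{n\to\infty}\frac{S_L^{\otimes k}(n,\eta_n)}{n^{-k\eta_n/(1-\eta_n)}}=1;$$ 3. consequently the local bound obeys perfect parallel repetition in the limit of large inputs: for every fixed $k\ge 0$, $$\lim_{n\to\infty}\frac{S_L^{\otimes k}(n,\eta_n)}{\bigl(S_L(n,\eta_n)\bigr)^k}=1 .$$ -/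

import Mathlib

open Filter Topology

noncomputable section

/-- A (finite) bipartite Bell game: inputs `x, y` are drawn with probability `p x y`, and the
outputs `a, b` are awarded the score `G a b x y ∈ [0, 1]`. -/
structure BellGame (X Y A B : Type) [Fintype X] [Fintype Y] where
  G : A → B → X → Y → ℝ
  p : X → Y → ℝ
  G_nonneg : ∀ a b x y, 0 ≤ G a b x y
  G_le_one : ∀ a b x y, G a b x y ≤ 1
  p_nonneg : ∀ x y, 0 ≤ p x y
  p_sum : ∑ x, ∑ y, p x y = 1

/-- `P a b x y = P(a, b | x, y)` is a local behavior: it is a mixture, over a shared hidden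
variable `l` with distribution `μ`, of products of local (randomized) response functions. -/
def IsLocalBehavior {X Y A B : Type} [Fintype A] [Fintype B] (P : A → B → X → Y → ℝ) : Prop :=
  ∃ (r : ℕ) (μ : Fin r → ℝ) (PA : Fin r → X → A → ℝ) (PB : Fin r → Y → B → ℝ),
    (∀ l, 0 ≤ μ l) ∧ ∑ l, μ l = 1 ∧
    (∀ l x a, 0 ≤ PA l x a) ∧ (∀ l x, ∑ a, PA l x a = 1) ∧
    (∀ l y b, 0 ≤ PB l y b) ∧ (∀ l y, ∑ b, PB l y b = 1) ∧
    ∀ a b x y, P a b x y = ∑ l, μ l * (PA l x a * PB l y b)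

namespace BellGame

variable {X Y A B : Type} [Fintype X] [Fintype Y] [Fintype A] [Fintype B]

/-- The score `S` of the behavior `P` in the game. -/
def score (g : BellGame X Y A B) (P : A → B → X → Y → ℝ) : ℝ :=
  ∑ x, ∑ y, ∑ a, ∑ b, g.G a b x y * P a b x y * g.p x y

/-- The local bound `S_L`: the largest score achievable by local behaviors. -/
def localBound (g : BellGame X Y A B) : ℝ :=
  sSup {s | ∃ P : A → B → X → Y → ℝ, IsLocalBehavior P ∧ g.score P = s}

/-- The score of a local behavior is at most one. -/
theorem score_le_one (g : BellGame X Y A B) {P : A → B → X → Y → ℝ} (hP : IsLocalBehavior P) :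
    g.score P ≤ 1 := by
  obtain ⟨r, μ, PA, PB, hμ, hμ1, hA, hA1, hB, hB1, hP⟩ := hP
  have hP0 : ∀ a b x y, 0 ≤ P a b x y := fun a b x y => by
    rw [hP]
    exact Finset.sum_nonneg fun l _ => mul_nonneg (hμ l) (mul_nonneg (hA l x a) (hB l y b))
  have hP1 : ∀ x y, ∑ a, ∑ b, P a b x y = 1 := fun x y => by
    calc ∑ a, ∑ b, P a b x y
        = ∑ a, ∑ l, ∑ b, μ l * (PA l x a * PB l y b) := by
          refine Finset.sum_congr rfl fun a _ => ?_
          rw [Finset.sum_comm]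
          exact Finset.sum_congr rfl fun b _ => hP a b x y
      _ = ∑ l, ∑ a, ∑ b, μ l * (PA l x a * PB l y b) := Finset.sum_comm
      _ = 1 := by simp only [← Finset.mul_sum, hB1, hA1, mul_one, hμ1]
  rw [← g.p_sum]
  refine Finset.sum_le_sum fun x _ => Finset.sum_le_sum fun y _ => ?_
  calc ∑ a, ∑ b, g.G a b x y * P a b x y * g.p x y
      ≤ ∑ a, ∑ b, P a b x y * g.p x y :=
        Finset.sum_le_sum fun a _ => Finset.sum_le_sum fun b _ =>
          mul_le_mul_of_nonneg_right
            (mul_le_of_le_one_left (hP0 a b x y) (g.G_le_one a b x y)) (g.p_nonneg x y)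
    _ = g.p x y := by simp only [← Finset.sum_mul, hP1, one_mul]

/-- The set of local scores is bounded, so the supremum that defines the local bound is genuine. -/
theorem bddAbove_localScores (g : BellGame X Y A B) :
    BddAbove {s | ∃ P : A → B → X → Y → ℝ, IsLocalBehavior P ∧ g.score P = s} :=
  ⟨1, fun _ ⟨_, hP, hs⟩ => hs ▸ g.score_le_one hP⟩

/-- The `k`-repetition of a game: `k` independently drawn pairs of inputs, answered jointly, with
the product of the individual scores. -/
def repetition (g : BellGame X Y A B) (k : ℕ) :
    BellGame (Fin k → X) (Fin k → Y) (Fin k → A) (Fin k → B) where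
  G a b x y := ∏ i, g.G (a i) (b i) (x i) (y i)
  p x y := ∏ i, g.p (x i) (y i)
  G_nonneg _ _ _ _ := Finset.prod_nonneg fun _ _ => g.G_nonneg _ _ _ _
  G_le_one _ _ _ _ := Finset.prod_le_one (fun _ _ => g.G_nonneg _ _ _ _)
    fun _ _ => g.G_le_one _ _ _ _
  p_nonneg _ _ := Finset.prod_nonneg fun _ _ => g.p_nonneg _ _
  p_sum := by
    have h1 : ∀ x : Fin k → X, ∑ y : Fin k → Y, ∏ i, g.p (x i) (y i) =
        ∏ i, ∑ y, g.p (x i) y := fun x =>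
      (Fintype.prod_sum fun i y => g.p (x i) y).symm
    simp only [h1]
    rw [← Fintype.prod_sum fun (_ : Fin k) x => ∑ y, g.p x y]
    simp [g.p_sum]

end BellGame

/-- Bit strings of length `n = 2 ^ m`, the positions being labeled by `j ∈ {0,1}^m`, with
addition modulo two. -/
abbrev BitString (m : ℕ) : Type := (Fin m → ZMod 2) → ZMod 2

/-- The Hadamard code: the words `h` with `h j = a · j` (mod 2) for some `a ∈ {0,1}^m`. -/
def hadamardCode (m : ℕ) : AddSubgroup (BitString m) where
  carrier := {h | ∃ a : Fin m → ZMod 2, ∀ j, h j = ∑ i, a i * j i}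
  zero_mem' := ⟨0, fun j => by simp⟩
  add_mem' := by
    rintro h h' ⟨a, ha⟩ ⟨a', ha'⟩
    exact ⟨a + a', fun j => by simp [ha, ha', add_mul, Finset.sum_add_distrib]⟩
  neg_mem' := by
    rintro h ⟨a, ha⟩
    exact ⟨-a, fun j => by simp [ha]⟩

/-- The orbits `{x + h : h ∈ H_n}` of bit strings under the Hadamard code. -/
def Orbit (m : ℕ) : Type := BitString m ⧸ hadamardCode m

/-- The orbit of a bit string. -/
def orbitOf {m : ℕ} (x : BitString m) : Orbit m := QuotientAddGroup.mk x

instance (m : ℕ) : Finite (Orbit m) :=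
  inferInstanceAs (Finite (BitString m ⧸ hadamardCode m))

instance (m : ℕ) : Fintype (Orbit m) := Fintype.ofFinite _

/-- The probability of the noise string `z`, whose bits are independent and equal to `1` with
probability `η`. -/
def noiseProb {m : ℕ} (η : ℝ) (z : BitString m) : ℝ :=
  ∏ j, if z j = 1 then η else 1 - η

theorem noiseProb_nonneg {m : ℕ} {η : ℝ} (hη : η ∈ Set.Ioo (0 : ℝ) (1 / 2)) (z : BitString m) :
    0 ≤ noiseProb η z := by
  obtain ⟨h0, h1⟩ := hη
  refine Finset.prod_nonneg fun j _ => ?_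
  split_ifs <;> linarith

theorem noiseProb_sum (m : ℕ) (η : ℝ) : ∑ z : BitString m, noiseProb η z = 1 := by
  have h := (Fintype.prod_sum fun (_ : Fin m → ZMod 2) (b : ZMod 2) =>
    if b = 1 then η else 1 - η).symm
  have h2 : ∑ b : ZMod 2, (if b = 1 then η else 1 - η) = 1 := by
    rw [show (Finset.univ : Finset (ZMod 2)) = {0, 1} from rfl]
    simp
  simpa [noiseProb, h2] using h

open scoped Classical in
/-- The probability of an event `E x z`, for `x` uniform in `{0,1}^n` and independent noise `z`. -/
def kvProb {m : ℕ} (η : ℝ) (E : BitString m → BitString m → Prop) : ℝ :=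
  ∑ x, ∑ z, if E x z then (Fintype.card (BitString m) : ℝ)⁻¹ * noiseProb η z else 0

theorem kvProb_nonneg {m : ℕ} {η : ℝ} (hη : η ∈ Set.Ioo (0 : ℝ) (1 / 2))
    (E : BitString m → BitString m → Prop) : 0 ≤ kvProb η E := by
  refine Finset.sum_nonneg fun x _ => Finset.sum_nonneg fun z _ => ?_
  split_ifs
  · exact mul_nonneg (by positivity) (noiseProb_nonneg hη z)
  · exact le_rfl

theorem kvProb_mono {m : ℕ} {η : ℝ} (hη : η ∈ Set.Ioo (0 : ℝ) (1 / 2))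
    {E F : BitString m → BitString m → Prop} (h : ∀ x z, E x z → F x z) :
    kvProb η E ≤ kvProb η F := by
  refine Finset.sum_le_sum fun x _ => Finset.sum_le_sum fun z _ => ?_
  have h0 : 0 ≤ (Fintype.card (BitString m) : ℝ)⁻¹ * noiseProb η z :=
    mul_nonneg (by positivity) (noiseProb_nonneg hη z)
  by_cases hE : E x z
  · simp [hE, h x z hE]
  · rw [if_neg hE]
    split_ifs
    · exact h0
    · exact le_rfl

open scoped Classical in
/-- The Khot–Vishnoi game with `n = 2 ^ m` and bias `η ∈ (0, 1/2)`. The referee draws `x` uniformly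
in `{0,1}^n` and a noise string `z`; Alice is given the orbit of `x` and Bob the orbit of `x + z`.
They have to output elements `a, b` of the orbits they were given, and win iff `a + b = z`.
As the players see only the orbits `u, v`, the score `G a b u v` is the conditional probability,
given the orbits, that the answers win (and it is `0` if an answer lies outside its orbit). -/
def kvGame (m : ℕ) (η : ℝ) (hη : η ∈ Set.Ioo (0 : ℝ) (1 / 2)) :
    BellGame (Orbit m) (Orbit m) (BitString m) (BitString m) where
  G a b u v :=
    if orbitOf a = u ∧ orbitOf b = v then
      kvProb η (fun x z => (orbitOf x = u ∧ orbitOf (x + z) = v) ∧ a + b = z) /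
        kvProb η (fun x z => orbitOf x = u ∧ orbitOf (x + z) = v)
    else 0
  p u v := kvProb η (fun x z => orbitOf x = u ∧ orbitOf (x + z) = v)
  G_nonneg a b u v := by
    split_ifs
    · exact div_nonneg (kvProb_nonneg hη _) (kvProb_nonneg hη _)
    · exact le_rfl
  G_le_one a b u v := by
    split_ifs
    · exact div_le_one_of_le₀ (kvProb_mono hη fun _ _ h => h.1) (kvProb_nonneg hη _)
    · exact zero_le_one
  p_nonneg u v := kvProb_nonneg hη _
  p_sum := by
    have h : ∀ (x z : BitString m) (w : ℝ),
        ∑ u : Orbit m, ∑ v : Orbit m, (if orbitOf x = u ∧ orbitOf (x + z) = v then w else 0)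
          = w := by
      intro x z w
      simp [ite_and]
    calc ∑ u : Orbit m, ∑ v : Orbit m, kvProb η (fun x z => orbitOf x = u ∧ orbitOf (x + z) = v)
        = ∑ x : BitString m, ∑ z : BitString m, ∑ u : Orbit m, ∑ v : Orbit m,
            (if orbitOf x = u ∧ orbitOf (x + z) = v then
              (Fintype.card (BitString m) : ℝ)⁻¹ * noiseProb η z else 0) := by
          simp only [kvProb]
          rw [Finset.sum_congr rfl fun u _ => Finset.sum_comm, Finset.sum_comm]
          refine Finset.sum_congr rfl fun x _ => ?_
          rw [Finset.sum_congr rfl fun u _ => Finset.sum_comm, Finset.sum_comm]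
          congr!
      _ = 1 := by
          simp only [h, ← Finset.mul_sum, noiseProb_sum]
          simp

/-- The bias `η = 1/2 - 1 / log₂ n` for `n = 2 ^ m`. -/
def kvBias (m : ℕ) : ℝ := 1 / 2 - 1 / Real.logb 2 ((2 : ℝ) ^ m)

/-- For `m ≥ 3`, that is `n ≥ 8`, this bias lies in `(0, 1/2)`. -/
theorem kvBias_mem (m : ℕ) : kvBias (m + 3) ∈ Set.Ioo (0 : ℝ) (1 / 2) := by
  have h : kvBias (m + 3) = 1 / 2 - 1 / ((m : ℝ) + 3) := by
    rw [kvBias, Real.logb_pow, Real.logb_self_eq_one (by norm_num)]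
    push_cast
    ring
  have hm : (0 : ℝ) ≤ m := Nat.cast_nonneg m
  have h1 : 1 / ((m : ℝ) + 3) ≤ 1 / 3 := one_div_le_one_div_of_le (by norm_num) (by linarith)
  have h2 : 0 < 1 / ((m : ℝ) + 3) := by positivity
  rw [h]
  constructor <;> linarith

end

noncomputable section


/-! Write ρ = 1 - 2η. A pair of answers determines the only inputs on which it can score, so a
product strategy scores ∑ κ(a,b) f(a) g(b), where κ is `kvKernel` (n times the law of a uniform
string and its noisy copy) and f(a) is the probability of answering a on the orbit of a.

Upper bound: hypercontractivity of the noise operator bounds this form by the ℓ^p norms of f and g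
with p = 1 + ρ = 2(1 - η) (`kernelBound_bitKernel`). Since 0 ≤ f ≤ 1 and f has mass at most 1 on
each orbit, ∑ f^p is at most the number of orbits, and n^(-η/(1-η)) results (`kv_bound_eq`). Such
bounds tensorize (`KernelBound.prod`): first over the n bits, then over the k repetitions, whose
bound is therefore exactly the k-th power.

Lower bound: each player picks an element of the orbit with probability proportional to the density
∏ (1 ± d), capped at M. If the orbit sums were all equal to n, then n times the score would be about
(1 + ρd²)^n. The inequality 1/(xy) ≥ 3 - x - y reduces their fluctuation to first moments, which the
balance of nonzero Hadamard words controls (`orbitResponse_score_ge`). For η = η_n, nd² = 2(1-ε) ln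
n and M = n^(1-ε/4), n times the score is asymptotically at least 16^(1-ε), while n times the upper
bound tends to 16; then ε → 0. Playing independently in each coordinate handles the repetitions. -/

/-! ### The two-point hypercontractive inequality. -/

theorem two_le_rpow_neg_add_rpow_neg {a b r : ℝ} (ha : 0 < a) (hb : 0 < b) (hab : a * b ≤ 1)
    (hr : 0 ≤ r) : 2 ≤ a ^ (-r) + b ^ (-r) := by
  have h1 : 0 < a ^ (-r) := Real.rpow_pos_of_pos ha _
  have h2 : 0 < b ^ (-r) := Real.rpow_pos_of_pos hb _
  have h3 : 1 ≤ a ^ (-r) * b ^ (-r) := by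
    rw [← Real.mul_rpow ha.le hb.le]
    exact Real.one_le_rpow_of_pos_of_le_one_of_nonpos (mul_pos ha hb) hab (by linarith)
  nlinarith [sq_nonneg (a ^ (-r) - b ^ (-r))]

theorem two_mul_le_one_add_rpow_sub_one_sub_rpow {q t : ℝ} (hq0 : 0 < q) (hq1 : q ≤ 1)
    (ht0 : 0 ≤ t) (ht1 : t ≤ 1) : 2 * q * t ≤ (1 + t) ^ q - (1 - t) ^ q := by
  have hmono : MonotoneOn (fun t : ℝ => (1 + t) ^ q - (1 - t) ^ q - 2 * q * t)
      (Set.Icc 0 1) := by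
    refine monotoneOn_of_hasDerivWithinAt_nonneg (convex_Icc 0 1) ?_
      (f' := fun t => q * ((1 + t) ^ (-(1 - q)) + (1 - t) ^ (-(1 - q)) - 2)) ?_ ?_
    · refine ContinuousOn.sub (ContinuousOn.sub ?_ ?_) (by fun_prop)
      · exact ContinuousOn.rpow_const (by fun_prop) fun x _ => Or.inr hq0.le
      · exact ContinuousOn.rpow_const (by fun_prop) fun x _ => Or.inr hq0.le
    · intro x hx
      rw [interior_Icc] at hx
      have h1 : HasDerivAt (fun t : ℝ => (1 + t) ^ q) (1 * q * (1 + x) ^ (q - 1)) x :=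
        ((hasDerivAt_id x).const_add 1).rpow_const (Or.inl (by simp; linarith [hx.1]))
      have h2 : HasDerivAt (fun t : ℝ => (1 - t) ^ q) (-1 * q * (1 - x) ^ (q - 1)) x :=
        ((hasDerivAt_id x).const_sub 1).rpow_const (Or.inl (by simp; linarith [hx.2]))
      have h3 : HasDerivAt (fun t : ℝ => 2 * q * t) (2 * q * 1) x :=
        (hasDerivAt_id x).const_mul (2 * q)
      refine ((h1.sub h2).sub h3).hasDerivWithinAt.congr_deriv ?_
      rw [neg_sub]
      ring
    · intro x hx
      rw [interior_Icc] at hx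
      have := two_le_rpow_neg_add_rpow_neg (a := 1 + x) (b := 1 - x) (r := 1 - q)
        (by linarith [hx.1]) (by linarith [hx.2]) (by nlinarith [sq_nonneg x]) (by linarith)
      exact mul_nonneg hq0.le (by linarith)
  have := hmono ⟨le_rfl, zero_le_one⟩ ⟨ht0, ht1⟩ ht0
  simp at this
  linarith

/-- Second-order Taylor bound at 0, integrated twice: the derivative of the gap is 1 + q times the
gap in the previous lemma, whose own derivative is nonnegative by AM-GM because (1 + t)(1 - t) ≤ 1.
-/
theorem two_add_le_one_add_rpow_add_one_sub_rpow {q t : ℝ} (hq0 : 0 < q) (hq1 : q ≤ 1)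
    (ht0 : 0 ≤ t) (ht1 : t ≤ 1) :
    2 + (1 + q) * q * t ^ 2 ≤ (1 + t) ^ (1 + q) + (1 - t) ^ (1 + q) := by
  have hmono : MonotoneOn
      (fun t : ℝ => (1 + t) ^ (1 + q) + (1 - t) ^ (1 + q) - (1 + q) * q * t ^ 2)
      (Set.Icc 0 1) := by
    refine monotoneOn_of_hasDerivWithinAt_nonneg (convex_Icc 0 1) ?_
      (f' := fun t => (1 + q) * ((1 + t) ^ q - (1 - t) ^ q - 2 * q * t)) ?_ ?_
    · refine ContinuousOn.sub (ContinuousOn.add ?_ ?_) (by fun_prop)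
      · exact ContinuousOn.rpow_const (by fun_prop) fun x _ => Or.inr (by linarith)
      · exact ContinuousOn.rpow_const (by fun_prop) fun x _ => Or.inr (by linarith)
    · intro x hx
      have h1 : HasDerivAt (fun t : ℝ => (1 + t) ^ (1 + q)) (1 * (1 + q) * (1 + x) ^ (1 + q - 1)) x :=
        ((hasDerivAt_id x).const_add 1).rpow_const (Or.inr (by linarith))
      have h2 : HasDerivAt (fun t : ℝ => (1 - t) ^ (1 + q))
          (-1 * (1 + q) * (1 - x) ^ (1 + q - 1)) x :=
        ((hasDerivAt_id x).const_sub 1).rpow_const (Or.inr (by linarith))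
      have h3 : HasDerivAt (fun t : ℝ => (1 + q) * q * t ^ 2)
          ((1 + q) * q * ((2 : ℕ) * x ^ (2 - 1))) x :=
        (hasDerivAt_pow 2 x).const_mul ((1 + q) * q)
      refine ((h1.add h2).sub h3).hasDerivWithinAt.congr_deriv ?_
      rw [add_sub_cancel_left]
      push_cast
      ring
    · intro x hx
      have hx' := interior_subset hx
      have := two_mul_le_one_add_rpow_sub_one_sub_rpow hq0 hq1 hx'.1 hx'.2
      exact mul_nonneg (by linarith) (by linarith)
  have := hmono ⟨le_rfl, zero_le_one⟩ ⟨ht0, ht1⟩ ht0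
  simp at this
  linarith

/-- The two-point hypercontractive inequality from `L^(1+q)` to `L^2`. -/
theorem two_point_hypercontractive {q a b : ℝ} (hq0 : 0 < q) (hq1 : q ≤ 1)
    (ha : 0 ≤ a) (hb : 0 ≤ b) :
    ((a + b) ^ 2 + q * (a - b) ^ 2) ^ ((1 + q) / 2) ≤ 2 ^ q * (a ^ (1 + q) + b ^ (1 + q)) := by
  wlog hab : b ≤ a generalizing a b
  · have := this hb ha (le_of_not_ge hab)
    rwa [add_comm b a, add_comm (b ^ _), ← neg_sub a b, neg_sq] at this
  rcases (add_nonneg ha hb).eq_or_lt with h | hs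
  · obtain rfl : a = 0 := by linarith
    obtain rfl : b = 0 := by linarith
    have h1 : (1 + q) / 2 ≠ 0 := by positivity
    have h2 : 1 + q ≠ 0 := by positivity
    simp [Real.zero_rpow h1, Real.zero_rpow h2]
  -- By homogeneity the inequality depends only on t, where a and b are s/2 times 1 + t and 1 - t.
  set s := a + b with hs_def
  set t := (a - b) / s with ht_def
  have ht0 : 0 ≤ t := div_nonneg (by linarith) hs.le
  have ht1 : t ≤ 1 := by rw [ht_def, div_le_one hs]; linarith
  have hd : a - b = s * t := by rw [ht_def]; field_simp
  have ha' : a = s / 2 * (1 + t) := by linarith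
  have hb' : b = s / 2 * (1 - t) := by linarith
  have h1 := two_add_le_one_add_rpow_add_one_sub_rpow hq0 hq1 ht0 ht1
  -- Bernoulli for the exponent (1 + q)/2 ≤ 1; the right side is exactly half the lower bound in
  -- `h1`.
  have h2 : (1 + q * t ^ 2) ^ ((1 + q) / 2) ≤ 1 + (1 + q) / 2 * (q * t ^ 2) :=
    rpow_one_add_le_one_add_mul_self (by nlinarith [mul_nonneg hq0.le (sq_nonneg t)])
      (by linarith) (by linarith)
  have h3 : (s ^ 2) ^ ((1 + q) / 2) = s ^ (1 + q) := by
    rw [← Real.rpow_natCast, ← Real.rpow_mul hs.le]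
    congr 1
    push_cast
    ring
  have h4 : (s / 2) ^ (1 + q) * 2 ^ q * 2 = s ^ (1 + q) := by
    rw [Real.div_rpow hs.le zero_le_two, Real.rpow_add two_pos, Real.rpow_one]
    field_simp
  have h5 : 0 ≤ s ^ (1 + q) := Real.rpow_nonneg hs.le _
  calc (s ^ 2 + q * (a - b) ^ 2) ^ ((1 + q) / 2)
      = (s ^ 2 * (1 + q * t ^ 2)) ^ ((1 + q) / 2) := by rw [hd]; congr 1; ring
    _ = s ^ (1 + q) * (1 + q * t ^ 2) ^ ((1 + q) / 2) := by
        rw [Real.mul_rpow (by positivity) (by positivity), h3]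
    _ ≤ s ^ (1 + q) * (((1 + t) ^ (1 + q) + (1 - t) ^ (1 + q)) / 2) :=
        mul_le_mul_of_nonneg_left (by linarith) h5
    _ = 2 ^ q * (a ^ (1 + q) + b ^ (1 + q)) := by
        rw [ha', hb', Real.mul_rpow (by positivity) (by linarith),
          Real.mul_rpow (by positivity) (by linarith), ← h4]
        ring

/-- Up to normalization, the left side is the L² norm of (a, b) after noise of correlation √q, and
the right side its L^(1+q) norm. -/
theorem sqrt_le_two_point {q a b : ℝ} (hq0 : 0 < q) (hq1 : q ≤ 1) (ha : 0 ≤ a) (hb : 0 ≤ b) :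
    √((a + b) ^ 2 + q * (a - b) ^ 2) ≤
      2 ^ (q / (1 + q)) * (a ^ (1 + q) + b ^ (1 + q)) ^ (1 / (1 + q)) := by
  have h0 : 0 ≤ (a + b) ^ 2 + q * (a - b) ^ 2 := by positivity
  have h1 : 0 ≤ a ^ (1 + q) + b ^ (1 + q) := by positivity
  have h := Real.rpow_le_rpow (z := 1 / (1 + q)) (by positivity)
    (two_point_hypercontractive hq0 hq1 ha hb) (by positivity)
  rw [← Real.rpow_mul h0, Real.mul_rpow (by positivity) h1, ← Real.rpow_mul zero_le_two,
    mul_one_div, mul_one_div] at h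
  rw [Real.sqrt_eq_rpow]
  convert h using 2
  field_simp

/-! ### Bilinear kernel bounds and their tensorization. -/

/-- The bilinear form with kernel `κ` is bounded by `C` on nonnegative functions in `ℓ^p`. -/
def KernelBound {α : Type*} [Fintype α] (κ : α → α → ℝ) (C p : ℝ) : Prop :=
  ∀ f g : α → ℝ, (∀ a, 0 ≤ f a) → (∀ a, 0 ≤ g a) →
    ∑ a, ∑ b, κ a b * (f a * g b) ≤ C * ((∑ a, f a ^ p) ^ (1 / p) * (∑ b, g b ^ p) ^ (1 / p))

/-- The transition kernel of one noisy bit. -/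
def bitKernel (η : ℝ) (x y : ZMod 2) : ℝ := if x + y = 1 then η else 1 - η

theorem ZMod.sum_two (f : ZMod 2 → ℝ) : ∑ x, f x = f 0 + f 1 := Fin.sum_univ_two f

theorem ZMod.one_add_one : (1 : ZMod 2) + 1 = 0 := rfl

/-- Noise of correlation q = 1 - 2η is the square of noise of correlation √q. Cauchy–Schwarz gives
one square root to f and one to g, and `sqrt_le_two_point` bounds each factor. -/
theorem kernelBound_bitKernel {η : ℝ} (hη : η ∈ Set.Ioo (0 : ℝ) (1 / 2)) :
    KernelBound (bitKernel η) (2 ^ (1 - 1 / (1 - η))) (2 * (1 - η)) := by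
  obtain ⟨h0, h1⟩ := hη
  intro f g hf hg
  obtain ⟨q, hq⟩ : ∃ q, q = 1 - 2 * η := ⟨_, rfl⟩
  have hη' : η = (1 - q) / 2 := by linarith
  have hq0 : 0 < q := by linarith
  have hq1 : q ≤ 1 := by linarith
  have hp : 2 * (1 - η) = 1 + q := by linarith
  have hF := sqrt_le_two_point hq0 hq1 (hf 0) (hf 1)
  have hG := sqrt_le_two_point hq0 hq1 (hg 0) (hg 1)
  rw [hp]
  simp only [ZMod.sum_two]
  set F := (f 0 ^ (1 + q) + f 1 ^ (1 + q)) ^ (1 / (1 + q))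
  set G := (g 0 ^ (1 + q) + g 1 ^ (1 + q)) ^ (1 / (1 + q))
  set A := (f 0 + f 1) ^ 2 + q * (f 0 - f 1) ^ 2 with hA
  set B := (g 0 + g 1) ^ 2 + q * (g 0 - g 1) ^ 2 with hB
  have hA0 : 0 ≤ A := by positivity
  have hB0 : 0 ≤ B := by positivity
  have hcs : (f 0 + f 1) * (g 0 + g 1) + q * ((f 0 - f 1) * (g 0 - g 1)) ≤ √A * √B := by
    rw [← Real.sqrt_mul hA0]
    refine Real.le_sqrt_of_sq_le ?_
    rw [hA, hB]
    nlinarith [mul_nonneg hq0.le (sq_nonneg ((f 0 + f 1) * (g 0 - g 1) -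
      (f 0 - f 1) * (g 0 + g 1)))]
  have hFG := mul_le_mul hF hG (Real.sqrt_nonneg _) ((Real.sqrt_nonneg _).trans hF)
  -- Each function contributes 2^(q/(1+q)); the division by 2 comes from writing the form as half of
  -- the left side of `hcs`.
  have hc : (2 : ℝ) ^ (1 - 1 / (1 - η)) = 2 ^ (q / (1 + q)) * 2 ^ (q / (1 + q)) / 2 := by
    rw [← Real.rpow_add two_pos]
    conv_rhs => rw [← Real.rpow_sub_one two_ne_zero]
    congr 1
    have : 1 - η = (1 + q) / 2 := by linarith
    rw [this]
    field_simp
    ring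
  rw [hc]
  have h01 : ((0 : ZMod 2) = 1) = False := by simp
  simp only [bitKernel, add_zero, zero_add, ZMod.one_add_one, h01, if_true, if_false, hη']
  nlinarith

theorem KernelBound.const_mul {α : Type*} [Fintype α] {κ : α → α → ℝ} {C p : ℝ}
    (h : KernelBound κ C p) {c : ℝ} (hc : 0 ≤ c) :
    KernelBound (fun a b => c * κ a b) (c * C) p := by
  intro f g hf hg
  simp only [mul_assoc, ← Finset.mul_sum]
  exact mul_le_mul_of_nonneg_left (by simpa only [mul_assoc] using h f g hf hg) hc

theorem KernelBound.of_equiv {α β : Type*} [Fintype α] [Fintype β] {κ : α → α → ℝ} {C p : ℝ}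
    (h : KernelBound κ C p) (e : β ≃ α) : KernelBound (fun a b => κ (e a) (e b)) C p := by
  intro f g hf hg
  have := h (f ∘ e.symm) (g ∘ e.symm) (fun _ => hf _) (fun _ => hg _)
  simp only [← e.sum_comp, Function.comp_apply, e.symm_apply_apply] at this
  exact this

/-- With the first coordinates fixed, κ' is bounded on the fibers; κ is then applied to the
functions a ↦ ‖f(a,·)‖_p, whose ℓ^p norm is that of f. -/
theorem KernelBound.prod {α β : Type*} [Fintype α] [Fintype β] {κ : α → α → ℝ} {κ' : β → β → ℝ}
    {C C' p : ℝ} (hκ : ∀ a b, 0 ≤ κ a b) (hC' : 0 ≤ C') (hp : 0 < p)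
    (h : KernelBound κ C p) (h' : KernelBound κ' C' p) :
    KernelBound (fun a b : α × β => κ a.1 b.1 * κ' a.2 b.2) (C * C') p := by
  intro f g hf hg
  have hF : ∀ f : α × β → ℝ, (∀ a, 0 ≤ f a) → ∀ a, 0 ≤ ∑ x, f (a, x) ^ p := fun f hf a =>
    Finset.sum_nonneg fun x _ => Real.rpow_nonneg (hf _) _
  have hpow : ∀ f : α × β → ℝ, (∀ a, 0 ≤ f a) →
      ∑ a, ((∑ x, f (a, x) ^ p) ^ (1 / p)) ^ p = ∑ c, f c ^ p := fun f hf => by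
    rw [Fintype.sum_prod_type]
    refine Finset.sum_congr rfl fun a _ => ?_
    rw [← Real.rpow_mul (hF f hf a), one_div_mul_cancel hp.ne', Real.rpow_one]
  have h1 := h (fun a => (∑ x, f (a, x) ^ p) ^ (1 / p)) (fun a => (∑ x, g (a, x) ^ p) ^ (1 / p))
    (fun a => Real.rpow_nonneg (hF f hf a) _) (fun a => Real.rpow_nonneg (hF g hg a) _)
  rw [hpow f hf, hpow g hg] at h1
  calc ∑ c, ∑ d, κ c.1 d.1 * κ' c.2 d.2 * (f c * g d)
      = ∑ a, ∑ b, κ a b * ∑ x, ∑ y, κ' x y * (f (a, x) * g (b, y)) := by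
        simp only [Fintype.sum_prod_type, Finset.mul_sum]
        refine Finset.sum_congr rfl fun a _ => ?_
        rw [Finset.sum_comm]
        exact Finset.sum_congr rfl fun b _ => Finset.sum_congr rfl fun x _ =>
          Finset.sum_congr rfl fun y _ => mul_assoc _ _ _
    _ ≤ ∑ a, ∑ b, κ a b * (C' * ((∑ x, f (a, x) ^ p) ^ (1 / p) *
          (∑ x, g (b, x) ^ p) ^ (1 / p))) :=
        Finset.sum_le_sum fun a _ => Finset.sum_le_sum fun b _ =>
          mul_le_mul_of_nonneg_left (h' _ _ (fun _ => hf _) fun _ => hg _) (hκ a b)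
    _ = C' * ∑ a, ∑ b, κ a b * ((∑ x, f (a, x) ^ p) ^ (1 / p) *
          (∑ x, g (b, x) ^ p) ^ (1 / p)) := by
        simp only [Finset.mul_sum]
        exact Finset.sum_congr rfl fun a _ => Finset.sum_congr rfl fun b _ => by ring
    _ ≤ C' * (C * ((∑ c, f c ^ p) ^ (1 / p) * (∑ d, g d ^ p) ^ (1 / p))) :=
        mul_le_mul_of_nonneg_left h1 hC'
    _ = C * C' * ((∑ c, f c ^ p) ^ (1 / p) * (∑ d, g d ^ p) ^ (1 / p)) := by ring

theorem KernelBound.pi_fin {α : Type*} [Fintype α] {κ : α → α → ℝ} {C p : ℝ}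
    (hκ : ∀ a b, 0 ≤ κ a b) (hC : 0 ≤ C) (hp : 0 < p) (h : KernelBound κ C p) (N : ℕ) :
    KernelBound (fun a b : Fin N → α => ∏ i, κ (a i) (b i)) (C ^ N) p := by
  induction N with
  | zero =>
    intro f g hf hg
    simp only [Fintype.sum_unique, Finset.univ_eq_empty, Finset.prod_empty, pow_zero, one_mul]
    rw [← Real.rpow_mul (hf _), ← Real.rpow_mul (hg _), mul_one_div_cancel hp.ne', Real.rpow_one,
      Real.rpow_one]
  | succ N ih =>
    have := (h.prod hκ (pow_nonneg hC N) hp ih).of_equiv (Fin.consEquiv fun _ => α).symm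
    simp only [Fin.prod_univ_succ, pow_succ' C N]
    exact this

/-- Kernel bounds tensorize. -/
theorem KernelBound.pi {α : Type*} [Fintype α] {κ : α → α → ℝ} {C p : ℝ}
    (hκ : ∀ a b, 0 ≤ κ a b) (hC : 0 ≤ C) (hp : 0 < p) (h : KernelBound κ C p)
    (ι : Type*) [Fintype ι] [DecidableEq ι] :
    KernelBound (fun a b : ι → α => ∏ i, κ (a i) (b i)) (C ^ Fintype.card ι) p := by
  have := (h.pi_fin hκ hC hp (Fintype.card ι)).of_equiv
    ((Fintype.equivFin ι).arrowCongr (Equiv.refl α))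
  simp only [← (Fintype.equivFin ι).prod_comp] at this
  simpa using this

/-! ### Games in which the answers determine the inputs. -/

namespace BellGame

variable {X A : Type} [Fintype X]

open scoped Classical in
/-- The only answers that can win on inputs `u, v` are those with `π a = u` and `π b = v`, and their
weighted score is then `κ a b`. -/
def IsFiberGame (g : BellGame X X A A) (π : A → X) (κ : A → A → ℝ) : Prop :=
  ∀ a b u v, g.G a b u v * g.p u v = if π a = u ∧ π b = v then κ a b else 0

variable {g : BellGame X X A A} {π : A → X} {κ : A → A → ℝ}

theorem IsFiberGame.repetition (h : g.IsFiberGame π κ) (k : ℕ) :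
    (g.repetition k).IsFiberGame (fun a i => π (a i)) (fun a b => ∏ i, κ (a i) (b i)) := by
  classical
  intro a b u v
  change (∏ i, g.G (a i) (b i) (u i) (v i)) * ∏ i, g.p (u i) (v i) = _
  rw [← Finset.prod_mul_distrib, Finset.prod_congr rfl fun i _ => h (a i) (b i) (u i) (v i)]
  split_ifs with huv
  · exact Finset.prod_congr rfl fun i _ =>
      if_pos ⟨congrFun huv.1 i, congrFun huv.2 i⟩
  · obtain ⟨i, hi⟩ : ∃ i, ¬(π (a i) = u i ∧ π (b i) = v i) := by
      by_contra! hc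
      exact huv ⟨funext fun i => (hc i).1, funext fun i => (hc i).2⟩
    exact Finset.prod_eq_zero (Finset.mem_univ i) (if_neg hi)

variable [Fintype A]

theorem IsFiberGame.score_eq (h : g.IsFiberGame π κ) (P : A → A → X → X → ℝ) :
    g.score P = ∑ a, ∑ b, κ a b * P a b (π a) (π b) := by
  classical
  calc g.score P = ∑ x, ∑ y, ∑ a, ∑ b, (if π a = x ∧ π b = y then κ a b * P a b x y else 0) := by
        refine Finset.sum_congr rfl fun x _ => Finset.sum_congr rfl fun y _ =>
          Finset.sum_congr rfl fun a _ => Finset.sum_congr rfl fun b _ => ?_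
        rw [mul_right_comm, h]
        split_ifs <;> simp
    _ = ∑ a, ∑ b, ∑ x, ∑ y, (if π a = x ∧ π b = y then κ a b * P a b x y else 0) := by
        rw [Finset.sum_congr rfl fun x _ => Finset.sum_comm, Finset.sum_comm]
        refine Finset.sum_congr rfl fun a _ => ?_
        rw [Finset.sum_congr rfl fun x _ => Finset.sum_comm, Finset.sum_comm]
    _ = ∑ a, ∑ b, κ a b * P a b (π a) (π b) := by
        simp [ite_and]

/-- Probabilities lie in [0, 1], so a power p ≥ 1 only decreases them; what remains is at most the
total mass 1 of each input. -/
theorem sum_response_rpow_le {p : ℝ} (hp : 1 ≤ p) (π : A → X) {R : X → A → ℝ}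
    (hR : ∀ x a, 0 ≤ R x a) (hR1 : ∀ x, ∑ a, R x a = 1) :
    ∑ a, R (π a) a ^ p ≤ Fintype.card X := by
  classical
  have hle : ∀ x a, R x a ≤ 1 := fun x a => by
    rw [← hR1 x]
    exact Finset.single_le_sum (fun b _ => hR x b) (Finset.mem_univ a)
  calc ∑ a, R (π a) a ^ p ≤ ∑ a, R (π a) a := Finset.sum_le_sum fun a _ => by
        simpa using Real.rpow_le_rpow_of_exponent_ge' (hR (π a) a) (hle _ _) zero_le_one hp
    _ ≤ ∑ a, ∑ x, R x a := Finset.sum_le_sum fun a _ =>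
        Finset.single_le_sum (f := fun x => R x a) (fun x _ => hR x a) (Finset.mem_univ (π a))
    _ = Fintype.card X := by
        rw [Finset.sum_comm]
        simp [hR1]

/-- A kernel bound limits the local bound of a fiber game. -/
theorem IsFiberGame.localBound_le (h : g.IsFiberGame π κ) {C p : ℝ} (hC : 0 ≤ C) (hp : 1 ≤ p)
    (hκ : KernelBound κ C p) :
    g.localBound ≤ C * ((Fintype.card X : ℝ) ^ (1 / p) * (Fintype.card X : ℝ) ^ (1 / p)) := by
  have hB : 0 ≤ C * ((Fintype.card X : ℝ) ^ (1 / p) * (Fintype.card X : ℝ) ^ (1 / p)) := by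
    positivity
  refine Real.sSup_le ?_ hB
  rintro s ⟨P, ⟨r, μ, PA, PB, hμ, hμ1, hA, hA1, hB', hB1, hP⟩, rfl⟩
  rw [h.score_eq]
  have h1 : ∀ R : X → A → ℝ, (∀ x a, 0 ≤ R x a) → (∀ x, ∑ a, R x a = 1) →
      (∑ a, R (π a) a ^ p) ^ (1 / p) ≤ (Fintype.card X : ℝ) ^ (1 / p) := fun R hR hR1 =>
    Real.rpow_le_rpow (Finset.sum_nonneg fun a _ => Real.rpow_nonneg (hR _ _) _)
      (sum_response_rpow_le hp π hR hR1) (by positivity)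
  have h0 : ∀ R : X → A → ℝ, (∀ x a, 0 ≤ R x a) → 0 ≤ (∑ a, R (π a) a ^ p) ^ (1 / p) :=
    fun R hR => Real.rpow_nonneg (Finset.sum_nonneg fun a _ => Real.rpow_nonneg (hR _ _) _) _
  calc ∑ a, ∑ b, κ a b * P a b (π a) (π b)
      = ∑ l, μ l * ∑ a, ∑ b, κ a b * (PA l (π a) a * PB l (π b) b) := by
        simp only [hP, Finset.mul_sum]
        rw [Finset.sum_congr rfl fun a _ => Finset.sum_comm, Finset.sum_comm]
        exact Finset.sum_congr rfl fun l _ => Finset.sum_congr rfl fun a _ =>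
          Finset.sum_congr rfl fun b _ => by ring
    _ ≤ ∑ l, μ l * (C * ((Fintype.card X : ℝ) ^ (1 / p) * (Fintype.card X : ℝ) ^ (1 / p))) := by
        refine Finset.sum_le_sum fun l _ => mul_le_mul_of_nonneg_left ?_ (hμ l)
        refine (hκ _ _ (fun a => hA l _ _) fun b => hB' l _ _).trans ?_
        refine mul_le_mul_of_nonneg_left ?_ hC
        exact mul_le_mul (h1 _ (hA l) (hA1 l)) (h1 _ (hB' l) (hB1 l)) (h0 _ (hB' l))
          (by positivity)
    _ = _ := by rw [← Finset.sum_mul, hμ1, one_mul]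

/-- Product strategies give lower bounds for the local bound of a fiber game. -/
theorem IsFiberGame.le_localBound (h : g.IsFiberGame π κ) {R : X → A → ℝ}
    (hR : ∀ x a, 0 ≤ R x a) (hR1 : ∀ x, ∑ a, R x a = 1) :
    ∑ a, ∑ b, κ a b * (R (π a) a * R (π b) b) ≤ g.localBound := by
  refine le_csSup g.bddAbove_localScores ⟨fun a b x y => R x a * R y b, ?_, h.score_eq _⟩
  exact ⟨1, fun _ => 1, fun _ => R, fun _ => R, by simp, by simp, fun _ => hR, fun _ => hR1,
    fun _ => hR, fun _ => hR1, by simp⟩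

/-- Using R independently in each coordinate makes the score factorize. -/
theorem IsFiberGame.pow_le_localBound_repetition (h : g.IsFiberGame π κ) {R : X → A → ℝ}
    (hR : ∀ x a, 0 ≤ R x a) (hR1 : ∀ x, ∑ a, R x a = 1) (k : ℕ) :
    (∑ a, ∑ b, κ a b * (R (π a) a * R (π b) b)) ^ k ≤ (g.repetition k).localBound := by
  refine le_of_eq_of_le ?_ ((h.repetition k).le_localBound
    (R := fun x a => ∏ i, R (x i) (a i)) (fun x a => Finset.prod_nonneg fun i _ => hR _ _)
    fun x => ?_)
  · have h1 : ∀ a : Fin k → A, ∑ b : Fin k → A, (∏ i, κ (a i) (b i)) *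
        ((∏ i, R (π (a i)) (a i)) * ∏ i, R (π (b i)) (b i)) =
        ∏ i, ∑ b, κ (a i) b * (R (π (a i)) (a i) * R (π b) b) := fun a => by
      simp only [← Finset.prod_mul_distrib]
      exact (Fintype.prod_sum fun i b => κ (a i) b * (R (π (a i)) (a i) * R (π b) b)).symm
    simp only [h1]
    rw [← Fintype.prod_sum fun (_ : Fin k) a => ∑ b, κ a b * (R (π a) a * R (π b) b)]
    simp
  · rw [← Fintype.prod_sum fun (i : Fin k) a => R (x i) a]
    simp [hR1]

end BellGame

/-! ### Orbits of the Hadamard code. -/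

section Hadamard

variable {m : ℕ}

/-- The code word of `c`. -/
def hadamardWord (c : Fin m → ZMod 2) : BitString m := fun j => ∑ i, c i * j i

theorem hadamardWord_add (c j j' : Fin m → ZMod 2) :
    hadamardWord c (j + j') = hadamardWord c j + hadamardWord c j' := by
  simp [hadamardWord, mul_add, Finset.sum_add_distrib]

theorem hadamardWord_single (c : Fin m → ZMod 2) (i : Fin m) :
    hadamardWord c (Pi.single i 1) = c i := by
  simp [hadamardWord, Pi.single_apply]

theorem hadamardWord_injective : Function.Injective (hadamardWord (m := m)) := fun c c' h =>
  funext fun i => by rw [← hadamardWord_single c, h, hadamardWord_single]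

theorem hadamardWord_mem (c : Fin m → ZMod 2) : hadamardWord c ∈ hadamardCode m :=
  ⟨c, fun _ => rfl⟩

theorem BitString.add_self (x : BitString m) : x + x = 0 :=
  funext fun _ => CharTwo.add_self_eq_zero _

theorem BitString.neg_eq (x : BitString m) : -x = x :=
  funext fun _ => CharTwo.neg_eq _

theorem orbitOf_eq_iff {x y : BitString m} : orbitOf x = orbitOf y ↔ x + y ∈ hadamardCode m := by
  refine (QuotientAddGroup.eq).trans ?_
  rw [BitString.neg_eq]

theorem orbitOf_add_hadamardWord (x : BitString m) (c : Fin m → ZMod 2) :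
    orbitOf (x + hadamardWord c) = orbitOf x := by
  rw [orbitOf_eq_iff, add_right_comm, BitString.add_self, zero_add]
  exact hadamardWord_mem c

theorem orbitOf_surjective (u : Orbit m) : ∃ x, orbitOf x = u := Quotient.exists_rep u

open scoped Classical in
/-- A sum over an orbit as a sum over the code words. -/
theorem sum_orbit (a : BitString m) (F : BitString m → ℝ) :
    ∑ x, (if orbitOf x = orbitOf a then F x else 0) = ∑ c, F (a + hadamardWord c) := by
  rw [← Finset.sum_filter]
  symm
  refine Finset.sum_nbij (fun c => a + hadamardWord c) (fun c _ => ?_) (fun c _ c' _ h => ?_)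
    (fun x hx => ?_) fun _ _ => rfl
  · simpa using orbitOf_add_hadamardWord a c
  · exact hadamardWord_injective (add_left_cancel h)
  · obtain ⟨c, hc⟩ := orbitOf_eq_iff.1 (Finset.mem_filter.1 (Finset.mem_coe.1 hx)).2
    refine ⟨c, by simp, ?_⟩
    have : hadamardWord c = x + a := funext fun j => (hc j).symm
    change a + hadamardWord c = x
    rw [this, add_comm x, ← add_assoc, BitString.add_self, zero_add]

theorem card_orbit_mul : Fintype.card (Orbit m) * 2 ^ m = Fintype.card (BitString m) := by
  have h1 : Nat.card (hadamardCode m) = 2 ^ m := by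
    have e : (Fin m → ZMod 2) ≃ hadamardCode m :=
      Equiv.ofBijective (fun c => ⟨hadamardWord c, hadamardWord_mem c⟩)
        ⟨fun c c' h => hadamardWord_injective (congrArg Subtype.val h),
          fun ⟨x, c, hc⟩ => ⟨c, Subtype.ext (funext fun j => (hc j).symm)⟩⟩
    rw [← Nat.card_congr e]
    simp
  rw [← Nat.card_eq_fintype_card, ← Nat.card_eq_fintype_card, ← h1]
  exact (AddSubgroup.card_eq_card_quotient_mul_card_addSubgroup _).symm

end Hadamard

/-! ### The upper bound for the Khot–Vishnoi game. -/

/-- The weighted score of a pair of answers in the Khot–Vishnoi game. -/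
def kvKernel {m : ℕ} (η : ℝ) (a b : BitString m) : ℝ :=
  2 ^ m / Fintype.card (BitString m) * ∏ j, bitKernel η (a j) (b j)

/-- Multiplying the conditional score by the input probability restores the joint probability that x
lies in the orbit of a and z = a + b. The n choices of x in that orbit produce the factor `2 ^ m`.
-/
theorem isFiberGame_kvGame (m : ℕ) (η : ℝ) (hη : η ∈ Set.Ioo (0 : ℝ) (1 / 2)) :
    (kvGame m η hη).IsFiberGame orbitOf (kvKernel η) := by
  classical
  intro a b u v
  have hE : ∀ c d : BitString m, c + d = 0 ↔ c = d := fun c d => by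
    rw [← BitString.neg_eq d, ← sub_eq_add_neg, sub_eq_zero, BitString.neg_eq]
  simp only [kvGame]
  split_ifs with huv
  · rw [div_mul_cancel_of_imp fun h0 => le_antisymm
      ((kvProb_mono hη fun _ _ h => h.1).trans h0.le) (kvProb_nonneg hη _)]
    obtain ⟨rfl, rfl⟩ := huv
    -- Once x is in the orbit of a and z = a + b, the condition on the orbit of x + z is automatic.
    have hiff : ∀ x z : BitString m, ((orbitOf x = orbitOf a ∧ orbitOf (x + z) = orbitOf b) ∧
        a + b = z) ↔ orbitOf x = orbitOf a ∧ a + b = z := fun x z => by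
      refine ⟨fun h => ⟨h.1.1, h.2⟩, ?_⟩
      rintro ⟨h1, rfl⟩
      refine ⟨⟨h1, ?_⟩, rfl⟩
      rw [orbitOf_eq_iff] at h1 ⊢
      rwa [← add_assoc, add_assoc, BitString.add_self, add_zero]
    simp only [kvProb, hiff, ite_and]
    have h2 : ∀ x : BitString m, (∑ z, if orbitOf x = orbitOf a then
        if a + b = z then (Fintype.card (BitString m) : ℝ)⁻¹ * noiseProb η z else 0 else 0) =
        if orbitOf x = orbitOf a then
          (Fintype.card (BitString m) : ℝ)⁻¹ * noiseProb η (a + b) else 0 := fun x => by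
      split_ifs <;> simp
    simp only [h2]
    rw [sum_orbit a fun _ => (Fintype.card (BitString m) : ℝ)⁻¹ * noiseProb η (a + b)]
    simp [kvKernel, noiseProb, bitKernel, div_eq_mul_inv, mul_assoc]
  · rw [zero_mul]

theorem bitKernel_nonneg {η : ℝ} (hη : η ∈ Set.Ioo (0 : ℝ) (1 / 2)) (x y : ZMod 2) :
    0 ≤ bitKernel η x y := by
  obtain ⟨h0, h1⟩ := hη
  rw [bitKernel]
  split_ifs <;> linarith

theorem kvKernel_nonneg {m : ℕ} {η : ℝ} (hη : η ∈ Set.Ioo (0 : ℝ) (1 / 2)) (a b : BitString m) :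
    0 ≤ kvKernel η a b :=
  mul_nonneg (by positivity) (Finset.prod_nonneg fun _ _ => bitKernel_nonneg hη _ _)

theorem kernelBound_kvKernel (m : ℕ) {η : ℝ} (hη : η ∈ Set.Ioo (0 : ℝ) (1 / 2)) :
    KernelBound (kvKernel (m := m) η)
      (2 ^ m * (Fintype.card (BitString m) : ℝ) ^ (-(1 / (1 - η)))) (2 * (1 - η)) := by
  have h := ((kernelBound_bitKernel hη).pi (bitKernel_nonneg hη) (by positivity)
    (by linarith [hη.2]) (Fin m → ZMod 2)).const_mul
    (c := 2 ^ m / Fintype.card (BitString m)) (by positivity)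
  suffices e : 2 ^ m * (Fintype.card (BitString m) : ℝ) ^ (-(1 / (1 - η))) =
      2 ^ m / Fintype.card (BitString m) *
        ((2 : ℝ) ^ (1 - 1 / (1 - η))) ^ Fintype.card (Fin m → ZMod 2) by
    rw [e]
    exact h
  have hN : (Fintype.card (BitString m) : ℝ) = 2 ^ (Fintype.card (Fin m → ZMod 2)) := by simp
  have hN0 : (0 : ℝ) < Fintype.card (BitString m) := by positivity
  have e1 : ((2 : ℝ) ^ (1 - 1 / (1 - η))) ^ Fintype.card (Fin m → ZMod 2) =
      (Fintype.card (BitString m) : ℝ) ^ (1 - 1 / (1 - η)) := by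
    rw [hN, ← Real.rpow_natCast, ← Real.rpow_natCast, ← Real.rpow_mul zero_le_two,
      ← Real.rpow_mul zero_le_two, mul_comm]
  rw [e1, sub_eq_add_neg 1 (1 / (1 - η)), Real.rpow_add hN0, Real.rpow_one]
  field_simp

theorem card_orbit_eq (m : ℕ) :
    (Fintype.card (Orbit m) : ℝ) = Fintype.card (BitString m) / 2 ^ m := by
  rw [eq_div_iff (by positivity)]
  exact_mod_cast card_orbit_mul

/-- As 2/p = 1/(1 - η), the two ℓ^p norms contribute the number of orbits to this power. The number
of strings cancels and only a power of n survives. -/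
theorem kv_bound_eq (m : ℕ) {η : ℝ} (hη : η ∈ Set.Ioo (0 : ℝ) (1 / 2)) :
    2 ^ m * (Fintype.card (BitString m) : ℝ) ^ (-(1 / (1 - η))) *
      (Fintype.card (Orbit m) : ℝ) ^ (1 / (1 - η)) = ((2 : ℝ) ^ m) ^ (-(η / (1 - η))) := by
  have hN0 : (0 : ℝ) < Fintype.card (BitString m) := by positivity
  have hq : (0 : ℝ) < 2 ^ m := by positivity
  have hη1 : 0 < 1 - η := by linarith [hη.2]
  have e : -(η / (1 - η)) = 1 - 1 / (1 - η) := by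
    field_simp
    ring
  rw [card_orbit_eq, e, Real.rpow_sub hq, Real.rpow_one, Real.div_rpow hN0.le hq.le,
    Real.rpow_neg hN0.le]
  have := (Real.rpow_pos_of_pos hN0 (1 / (1 - η))).ne'
  field_simp

theorem kvGame_localBound_le (m : ℕ) (η : ℝ) (hη : η ∈ Set.Ioo (0 : ℝ) (1 / 2)) :
    (kvGame m η hη).localBound ≤ ((2 : ℝ) ^ m) ^ (-(η / (1 - η))) := by
  have hη1 : 0 < 1 - η := by linarith [hη.2]
  refine ((isFiberGame_kvGame m η hη).localBound_le (by positivity) (by linarith [hη.2])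
    (kernelBound_kvKernel m hη)).trans_eq ?_
  have hO : (0 : ℝ) < Fintype.card (Orbit m) := by
    rw [card_orbit_eq]
    positivity
  rw [← kv_bound_eq m hη, ← Real.rpow_add hO]
  congr 2
  field_simp
  ring

theorem rpow_neg_mul_div_eq_pow (m k : ℕ) (η : ℝ) :
    ((2 : ℝ) ^ m) ^ (-((k : ℝ) * η / (1 - η))) = (((2 : ℝ) ^ m) ^ (-(η / (1 - η)))) ^ k := by
  rw [← Real.rpow_natCast _ k, ← Real.rpow_mul (by positivity)]
  congr 1
  ring

theorem kvGame_repetition_localBound_le (m : ℕ) (η : ℝ) (hη : η ∈ Set.Ioo (0 : ℝ) (1 / 2))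
    (k : ℕ) : ((kvGame m η hη).repetition k).localBound
      ≤ ((2 : ℝ) ^ m) ^ (-((k : ℝ) * η / (1 - η))) := by
  have hη1 : 0 < 1 - η := by linarith [hη.2]
  refine (((isFiberGame_kvGame m η hη).repetition k).localBound_le (by positivity)
    (by linarith [hη.2]) ((kernelBound_kvKernel m hη).pi (kvKernel_nonneg hη)
    (by positivity) (by linarith) (Fin k))).trans_eq ?_
  have hO : (0 : ℝ) < Fintype.card (Orbit m) := by
    rw [card_orbit_eq]
    positivity
  have hX : (Fintype.card (Fin k → Orbit m) : ℝ) = (Fintype.card (Orbit m) : ℝ) ^ k := by simp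
  rw [rpow_neg_mul_div_eq_pow, ← kv_bound_eq m hη, hX, Fintype.card_fin,
    ← Real.rpow_add (by positivity), mul_pow _ ((Fintype.card (Orbit m) : ℝ) ^ _) k]
  congr 1
  rw [← Real.rpow_natCast, ← Real.rpow_natCast, ← Real.rpow_mul hO.le, ← Real.rpow_mul hO.le]
  congr 1
  field_simp
  ring

/-! ### Moments of the tilted density under the correlated law. -/

theorem Real.sinh_le_self_mul_cosh {x : ℝ} (hx : 0 ≤ x) : Real.sinh x ≤ x * Real.cosh x := by
  have hmono : MonotoneOn (fun x : ℝ => x * Real.cosh x - Real.sinh x) (Set.Ici 0) := by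
    refine monotoneOn_of_hasDerivWithinAt_nonneg (convex_Ici 0) (by fun_prop)
      (f' := fun x => x * Real.sinh x) (fun x _ => ?_) fun x hx => ?_
    · refine (((hasDerivAt_id x).mul (Real.hasDerivAt_cosh x)).sub
        (Real.hasDerivAt_sinh x)).hasDerivWithinAt.congr_deriv ?_
      simp
    · have hx' : 0 ≤ x := interior_subset hx
      exact mul_nonneg hx' (Real.sinh_nonneg_iff.2 hx')
  have := hmono Set.self_mem_Ici hx hx
  simp at this
  linarith

/-- The quadratic term must be kept: nd² will be of order log n, so it affects the exponent of n.
The cubic term will be negligible. -/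
theorem one_add_le_exp_sub_sq {u : ℝ} (hu : |u| ≤ 1 / 2) :
    1 + u ≤ Real.exp (u - u ^ 2 / 2 + 2 * |u| ^ 3) := by
  have h := Real.abs_log_sub_add_sum_range_le (x := -u) (by rw [abs_neg]; linarith) 2
  have hu' := abs_le.1 hu
  rw [abs_neg, sub_neg_eq_add] at h
  have h1 : |u| ^ (2 + 1) / (1 - |u|) ≤ 2 * |u| ^ 3 := by
    have h0 := abs_nonneg u
    generalize |u| = v at *
    rw [div_le_iff₀ (by linarith), show 2 + 1 = 3 from rfl]
    nlinarith [mul_nonneg (pow_nonneg h0 3) (by linarith : 0 ≤ 1 - 2 * v)]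
  have h2 := (abs_le.1 h).2
  norm_num [Finset.sum_range_succ] at h2
  rw [← Real.log_le_iff_le_exp (by linarith)]
  norm_num at h1
  linarith

/-- The sign `±1` of a bit. -/
def bitSign (x : ZMod 2) : ℝ := if x = 1 then -1 else 1

/-- The density, with respect to the uniform measure, of independent bits of bias `d`. -/
def tilt {m : ℕ} (d : ℝ) (a : BitString m) : ℝ := ∏ j, (1 + d * bitSign (a j))

/-- The joint law of a uniform string and its noisy copy. -/
def pairProb {m : ℕ} (η : ℝ) (a b : BitString m) : ℝ := ∏ j, bitKernel η (a j) (b j) / 2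

theorem kvKernel_eq {m : ℕ} (η : ℝ) (a b : BitString m) :
    kvKernel η a b = 2 ^ m * pairProb η a b := by
  simp [kvKernel, pairProb, Finset.prod_div_distrib]
  ring

theorem pairProb_nonneg {m : ℕ} {η : ℝ} (hη : η ∈ Set.Ioo (0 : ℝ) (1 / 2)) (a b : BitString m) :
    0 ≤ pairProb η a b :=
  Finset.prod_nonneg fun _ _ => div_nonneg (bitKernel_nonneg hη _ _) zero_le_two

theorem pairProb_comm {m : ℕ} (η : ℝ) (a b : BitString m) : pairProb η a b = pairProb η b a := by
  simp only [pairProb, bitKernel, add_comm]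

theorem bitSign_mem (x : ZMod 2) : bitSign x = 1 ∨ bitSign x = -1 := by
  rw [bitSign]
  split_ifs <;> simp

theorem one_add_mul_bitSign_pos {d : ℝ} (hd : d ∈ Set.Ioc (0 : ℝ) (1 / 2)) (x : ZMod 2) :
    0 < 1 + d * bitSign x := by
  rcases bitSign_mem x with h | h <;> rw [h] <;> linarith [hd.1, hd.2]

theorem tilt_pos {m : ℕ} {d : ℝ} (hd : d ∈ Set.Ioc (0 : ℝ) (1 / 2)) (a : BitString m) :
    0 < tilt d a := Finset.prod_pos fun _ _ => one_add_mul_bitSign_pos hd _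

/-- The positions are independent, so expectations of products factorize. -/
theorem sum_pairProb_mul_prod {m : ℕ} (η : ℝ)
    (φ : (Fin m → ZMod 2) → ZMod 2 → ZMod 2 → ℝ) :
    ∑ a : BitString m, ∑ b : BitString m, pairProb η a b * ∏ j, φ j (a j) (b j) =
      ∏ j, ∑ x, ∑ y, bitKernel η x y / 2 * φ j x y := by
  rw [Fintype.prod_sum fun j x => ∑ y, bitKernel η x y / 2 * φ j x y]
  refine Finset.sum_congr rfl fun a _ => ?_
  rw [Fintype.prod_sum fun j y => bitKernel η (a j) y / 2 * φ j (a j) y]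
  refine Finset.sum_congr rfl fun b _ => ?_
  rw [pairProb, Finset.prod_mul_distrib]

theorem card_positions (m : ℕ) : Fintype.card (Fin m → ZMod 2) = 2 ^ m := by simp

/-- The evaluation of an average over a pair of correlated bits. -/
theorem sum_bitKernel (η : ℝ) (F : ZMod 2 → ZMod 2 → ℝ) :
    ∑ x, ∑ y, bitKernel η x y / 2 * F x y =
      (1 - η) / 2 * (F 0 0 + F 1 1) + η / 2 * (F 0 1 + F 1 0) := by
  have h01 : ((0 : ZMod 2) = 1) = False := by simp
  simp only [ZMod.sum_two, bitKernel, add_zero, zero_add, ZMod.one_add_one, h01, if_true, if_false]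
  ring

theorem bitSign_zero : bitSign 0 = 1 := by simp [bitSign]

theorem bitSign_one : bitSign 1 = -1 := by simp [bitSign]

theorem sum_pairProb_tilt {m : ℕ} (η d : ℝ) :
    ∑ a : BitString m, ∑ b : BitString m, pairProb η a b * (tilt d a * tilt d b) =
      (1 + (1 - 2 * η) * d ^ 2) ^ (2 ^ m) := by
  simp only [tilt, ← Finset.prod_mul_distrib]
  rw [sum_pairProb_mul_prod η fun _ x y => (1 + d * bitSign x) * (1 + d * bitSign y)]
  rw [Finset.prod_const, Finset.card_univ, card_positions, sum_bitKernel, bitSign_zero, bitSign_one]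
  congr 1
  ring

/-- A product along a nonzero code word takes both values equally often. -/
theorem prod_hadamardWord_le {m : ℕ} {c : Fin m → ZMod 2} (hc : c ≠ 0) (F : ZMod 2 → ℝ) {D : ℝ}
    (hD : 0 ≤ D) (hF : 0 ≤ F 0) (hF1 : 0 ≤ F 1) (h : F 0 * F 1 ≤ D ^ 2) :
    ∏ j, F (hadamardWord c j) ≤ D ^ (2 ^ m) := by
  obtain ⟨i, hi⟩ := Function.ne_iff.1 hc
  have hi1 : c i = 1 := by
    have : ∀ x : ZMod 2, x ≠ 0 → x = 1 := by decide
    exact this _ hi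
  have h2 : ∀ x : ZMod 2, F x * F (x + 1) = F 0 * F 1 := fun x => by
    have : x = 0 ∨ x = 1 := by revert x; decide
    rcases this with rfl | rfl
    · rw [zero_add]
    · rw [ZMod.one_add_one, mul_comm]
  -- In the square, position j is paired with j + e_i where c_i = 1; the word flips under this
  -- shift, so every pair contributes F 0 * F 1.
  refine le_of_sq_le_sq ?_ (by positivity)
  calc (∏ j, F (hadamardWord c j)) ^ 2
      = (∏ j, F (hadamardWord c j)) * ∏ j, F (hadamardWord c (j + Pi.single i 1)) := by
        rw [sq]
        congr 1
        exact (Equiv.prod_comp (Equiv.addRight (Pi.single i 1)) fun j => F (hadamardWord c j)).symm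
    _ = ∏ _j : Fin m → ZMod 2, F 0 * F 1 := by
        rw [← Finset.prod_mul_distrib]
        refine Finset.prod_congr rfl fun j _ => ?_
        rw [hadamardWord_add, hadamardWord_single, hi1, h2]
    _ ≤ (D ^ (2 ^ m)) ^ 2 := by
        rw [Finset.prod_const, Finset.card_univ, card_positions, ← pow_mul D,
          mul_comm (2 ^ m) 2, pow_mul D]
        exact pow_le_pow_left₀ (mul_nonneg hF hF1) h _

/-- With ρ = 1 - 2η, a position contributes 1 + d² + 2ρd² where the word is 0 and 1 - d² where it is
1. The d² terms cancel to first order in the product, which is at most (1 + ρd²)²; a shift by a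
nonzero word thus costs nothing over `sum_pairProb_tilt`. -/
theorem sum_pairProb_tilt_shift_le {m : ℕ} {η d : ℝ} (hη : η ∈ Set.Ioo (0 : ℝ) (1 / 2))
    (hd : d ∈ Set.Ioc (0 : ℝ) (1 / 2)) {c : Fin m → ZMod 2} (hc : c ≠ 0) :
    ∑ a : BitString m, ∑ b : BitString m,
      pairProb η a b * (tilt d a * tilt d b * tilt d (a + hadamardWord c)) ≤
      (1 + (1 - 2 * η) * d ^ 2) ^ (2 ^ m) := by
  obtain ⟨h0, h1⟩ := hη
  obtain ⟨hd0, hd1⟩ := hd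
  have hd2 : d ^ 2 ≤ 1 := by nlinarith
  simp only [tilt, Pi.add_apply, ← Finset.prod_mul_distrib]
  rw [sum_pairProb_mul_prod η fun j x y => (1 + d * bitSign x) * (1 + d * bitSign y) *
    (1 + d * bitSign (x + hadamardWord c j))]
  have e0 : ∑ x, ∑ y, bitKernel η x y / 2 * ((1 + d * bitSign x) * (1 + d * bitSign y) *
    (1 + d * bitSign (x + 0))) = 1 + d ^ 2 + 2 * (1 - 2 * η) * d ^ 2 := by
    rw [sum_bitKernel]
    simp only [add_zero, bitSign_zero, bitSign_one]
    ring
  have e1 : ∑ x, ∑ y, bitKernel η x y / 2 * ((1 + d * bitSign x) * (1 + d * bitSign y) *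
    (1 + d * bitSign (x + 1))) = 1 - d ^ 2 := by
    rw [sum_bitKernel]
    simp only [zero_add, ZMod.one_add_one, bitSign_zero, bitSign_one]
    ring
  have hρ : 0 ≤ (1 - 2 * η) * d ^ 2 := mul_nonneg (by linarith) (sq_nonneg d)
  refine prod_hadamardWord_le hc (fun w => ∑ x, ∑ y, bitKernel η x y / 2 *
    ((1 + d * bitSign x) * (1 + d * bitSign y) * (1 + d * bitSign (x + w))))
    (by linarith) ?_ ?_ ?_
  · rw [e0]
    linarith [sq_nonneg d]
  · rw [e1]
    linarith
  · rw [e0, e1]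
    nlinarith [mul_nonneg hρ (sq_nonneg d), sq_nonneg (d ^ 2), sq_nonneg ((1 - 2 * η) * d ^ 2)]

/-- Chernoff bound: under the noise-correlated tilted law, the density rarely exceeds `M`. -/
theorem sum_pairProb_tilt_large_le {m : ℕ} {η d M s : ℝ} (hη : η ∈ Set.Ioo (0 : ℝ) (1 / 2))
    (hd : d ∈ Set.Ioc (0 : ℝ) (1 / 2)) (hM : 0 < M) (hs : s ∈ Set.Ioc (0 : ℝ) 1) :
    ∑ a : BitString m, ∑ b : BitString m,
      pairProb η a b * (tilt d a * tilt d b * if M < tilt d a then 1 else 0) ≤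
      Real.exp (2 ^ m * d ^ 2 * (s * (1 + s) / 2 + 2 * (1 - 2 * η) + 2 * d)) / M ^ s := by
  obtain ⟨hd0, hd1⟩ := hd
  obtain ⟨hs0, hs1⟩ := hs
  have hρ : 0 < 1 - 2 * η := by linarith [hη.2]
  have hMs : 0 < M ^ s := Real.rpow_pos_of_pos hM s
  set E : ZMod 2 → ℝ := fun x => Real.exp (s * (d * bitSign x - d ^ 2 / 2 + 2 * d ^ 3)) with hE
  have hbit : ∀ x, (1 + d * bitSign x) ^ s ≤ E x := fun x => by
    have habs : |d * bitSign x| = d := by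
      rcases bitSign_mem x with h | h <;> simp [h, abs_of_pos hd0]
    have hsq : (d * bitSign x) ^ 2 = d ^ 2 := by rw [← sq_abs, habs]
    have h := one_add_le_exp_sub_sq (u := d * bitSign x) (by rw [habs]; exact hd1)
    rw [habs, hsq] at h
    rw [hE]
    refine (Real.rpow_le_rpow (one_add_mul_bitSign_pos ⟨hd0, hd1⟩ x).le h hs0.le).trans_eq ?_
    rw [← Real.exp_mul, mul_comm]
  -- Markov's inequality for the s-th power: the indicator is at most (tilt / M)^s.
  have hind : ∀ a : BitString m, (if M < tilt d a then (1 : ℝ) else 0) ≤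
      (∏ j, E (a j)) / M ^ s := fun a => by
    have h1 : tilt d a ^ s ≤ ∏ j, E (a j) := by
      rw [tilt, ← Real.finsetProd_rpow _ _
        fun j _ => (one_add_mul_bitSign_pos ⟨hd0, hd1⟩ (a j)).le]
      exact Finset.prod_le_prod
        (fun j _ => Real.rpow_nonneg (one_add_mul_bitSign_pos ⟨hd0, hd1⟩ (a j)).le _)
        fun j _ => hbit _
    split_ifs with h
    · rw [one_le_div hMs]
      exact (Real.rpow_le_rpow hM.le h.le hs0.le).trans h1
    · exact div_nonneg (Finset.prod_nonneg fun j _ => (Real.exp_pos _).le) hMs.le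
  have hone : ∑ x, ∑ y, bitKernel η x y / 2 * ((1 + d * bitSign x) * (1 + d * bitSign y) * E x) ≤
      Real.exp (d ^ 2 * (s * (1 + s) / 2 + 2 * (1 - 2 * η) + 2 * d)) := by
    have hsd : 0 ≤ s * d := by positivity
    have hsinh := Real.sinh_le_self_mul_cosh hsd
    have hcosh := Real.cosh_le_exp_half_sq (s * d)
    have hcpos := Real.cosh_pos (s * d)
    have e : ∑ x, ∑ y, bitKernel η x y / 2 *
        ((1 + d * bitSign x) * (1 + d * bitSign y) * E x) =
        Real.exp (s * (- d ^ 2 / 2 + 2 * d ^ 3)) * ((1 + (1 - 2 * η) * d ^ 2) * Real.cosh (s * d) +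
          (1 + (1 - 2 * η)) * d * Real.sinh (s * d)) := by
      have e0 : E 0 = Real.exp (s * (- d ^ 2 / 2 + 2 * d ^ 3)) * Real.exp (s * d) := by
        rw [hE, ← Real.exp_add]
        simp only [bitSign_zero]
        congr 1
        ring
      have e1 : E 1 = Real.exp (s * (- d ^ 2 / 2 + 2 * d ^ 3)) * Real.exp (-(s * d)) := by
        rw [hE, ← Real.exp_add]
        simp only [bitSign_one]
        congr 1
        ring
      rw [sum_bitKernel, e0, e1, Real.cosh_eq, Real.sinh_eq, bitSign_zero, bitSign_one]
      ring
    rw [e]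
    calc _ ≤ Real.exp (s * (- d ^ 2 / 2 + 2 * d ^ 3)) * (Real.exp ((s * d) ^ 2 / 2) *
          Real.exp ((1 - 2 * η) * d ^ 2 + (1 + (1 - 2 * η)) * d * (s * d))) := by
          refine mul_le_mul_of_nonneg_left ?_ (Real.exp_pos _).le
          calc _ ≤ Real.cosh (s * d) *
                ((1 - 2 * η) * d ^ 2 + (1 + (1 - 2 * η)) * d * (s * d) + 1) := by
                have := mul_le_mul_of_nonneg_left hsinh
                  (by positivity : 0 ≤ (1 + (1 - 2 * η)) * d)
                linarith
            _ ≤ _ := mul_le_mul hcosh (Real.add_one_le_exp _) (by positivity) (Real.exp_pos _).le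
      _ ≤ _ := by
          rw [← Real.exp_add, ← Real.exp_add, Real.exp_le_exp]
          -- With ρ = 1 - 2η the exponent is d²(s(1+s)/2 + ρ + sρ + 2sd); s ≤ 1 removes s from the
          -- last two terms.
          have h1 : s * ((1 - 2 * η) * d ^ 2) ≤ 1 * ((1 - 2 * η) * d ^ 2) :=
            mul_le_mul_of_nonneg_right hs1 (by positivity)
          have h2 : s * d ^ 3 ≤ 1 * d ^ 3 := mul_le_mul_of_nonneg_right hs1 (by positivity)
          linarith
  calc _ ≤ ∑ a : BitString m, ∑ b : BitString m,
        pairProb η a b * (tilt d a * tilt d b * ((∏ j, E (a j)) / M ^ s)) :=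
        Finset.sum_le_sum fun a _ => Finset.sum_le_sum fun b _ =>
          mul_le_mul_of_nonneg_left (mul_le_mul_of_nonneg_left (hind a)
            (mul_pos (tilt_pos ⟨hd0, hd1⟩ a) (tilt_pos ⟨hd0, hd1⟩ b)).le) (pairProb_nonneg hη a b)
    _ = (∑ a : BitString m, ∑ b : BitString m,
        pairProb η a b * ∏ j, ((1 + d * bitSign (a j)) * (1 + d * bitSign (b j)) * E (a j))) /
          M ^ s := by
        simp only [Finset.sum_div, tilt, Finset.prod_mul_distrib]
        exact Finset.sum_congr rfl fun a _ => Finset.sum_congr rfl fun b _ => by ring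
    _ ≤ _ := by
        refine div_le_div_of_nonneg_right ?_ hMs.le
        rw [sum_pairProb_mul_prod η
          fun _ x y => (1 + d * bitSign x) * (1 + d * bitSign y) * E x]
        rw [Finset.prod_const, Finset.card_univ, card_positions]
        refine (pow_le_pow_left₀ ?_ hone _).trans_eq ?_
        · exact Finset.sum_nonneg fun x _ => Finset.sum_nonneg fun y _ =>
            mul_nonneg (div_nonneg (bitKernel_nonneg hη x y) zero_le_two)
              (mul_nonneg (mul_nonneg (one_add_mul_bitSign_pos ⟨hd0, hd1⟩ x).le
                (one_add_mul_bitSign_pos ⟨hd0, hd1⟩ y).le) (Real.exp_pos _).le)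
        · rw [← Real.exp_nat_mul]
          congr 1
          push_cast
          ring

/-! ### The capped tilted strategy and its score. -/

/-- Tangent plane at (1, 1) of the convex function 1/(xy). Applied to orbit sums divided by n, it
replaces denominators by first moments. -/
theorem three_sub_le_one_div_mul {x y : ℝ} (hx : 0 < x) (hy : 0 < y) :
    3 - x - y ≤ 1 / (x * y) := by
  rw [le_div_iff₀ (mul_pos hx hy)]
  nlinarith [mul_nonneg hx.le (sq_nonneg (y - 1)), mul_nonneg hy.le (sq_nonneg (x - 1)),
    mul_nonneg (add_pos hx hy).le (sq_nonneg (x - y)), sq_nonneg (x - y), sq_nonneg (x - 1),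
    sq_nonneg (y - 1), mul_pos hx hy]

/-- The capped tilted density. -/
def cappedTilt {m : ℕ} (d M : ℝ) (a : BitString m) : ℝ := min (tilt d a) M

open scoped Classical in
/-- The response function that picks an element of the given orbit with probability proportional
to the capped tilted density. -/
def orbitResponse {m : ℕ} (d M : ℝ) (u : Orbit m) (a : BitString m) : ℝ :=
  if orbitOf a = u then
    cappedTilt d M a / ∑ x, if orbitOf x = u then cappedTilt d M x else 0
  else 0

section

variable {m : ℕ} {η d M s : ℝ}

theorem cappedTilt_pos (hd : d ∈ Set.Ioc (0 : ℝ) (1 / 2)) (hM : 0 < M) (a : BitString m) :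
    0 < cappedTilt d M a := lt_min (tilt_pos hd a) hM

theorem orbitSum_pos (hd : d ∈ Set.Ioc (0 : ℝ) (1 / 2)) (hM : 0 < M) (a : BitString m) :
    0 < ∑ c, cappedTilt d M (a + hadamardWord c) :=
  Finset.sum_pos (fun _ _ => cappedTilt_pos hd hM _) Finset.univ_nonempty

theorem orbitResponse_self (d M : ℝ) (a : BitString m) :
    orbitResponse d M (orbitOf a) a =
      cappedTilt d M a / ∑ c, cappedTilt d M (a + hadamardWord c) := by
  rw [orbitResponse, if_pos rfl, sum_orbit]

theorem orbitResponse_nonneg (hd : d ∈ Set.Ioc (0 : ℝ) (1 / 2)) (hM : 0 < M) (u : Orbit m)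
    (a : BitString m) : 0 ≤ orbitResponse d M u a := by
  rw [orbitResponse]
  split_ifs with h
  · refine div_nonneg (cappedTilt_pos hd hM _).le (Finset.sum_nonneg fun x _ => ?_)
    split_ifs
    · exact (cappedTilt_pos hd hM _).le
    · exact le_rfl
  · exact le_rfl

theorem sum_orbitResponse (hd : d ∈ Set.Ioc (0 : ℝ) (1 / 2)) (hM : 0 < M) (u : Orbit m) :
    ∑ a, orbitResponse d M u a = 1 := by
  classical
  obtain ⟨y, rfl⟩ := orbitOf_surjective u
  have h := (orbitSum_pos hd hM y).ne'
  simp only [orbitResponse]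
  rw [sum_orbit y, sum_orbit y, ← Finset.sum_div]
  exact div_self h

/-- Only c = 0 needs the cap: there the density is correlated with itself and its mean would be too
large. Every other word contributes at most T even without the cap. -/
theorem sum_pairProb_orbitSum_le (hη : η ∈ Set.Ioo (0 : ℝ) (1 / 2))
    (hd : d ∈ Set.Ioc (0 : ℝ) (1 / 2)) :
    ∑ a : BitString m, ∑ b : BitString m, pairProb η a b * (tilt d a * tilt d b *
      ∑ c, cappedTilt d M (a + hadamardWord c)) ≤
      (M + 2 ^ m) * (1 + (1 - 2 * η) * d ^ 2) ^ (2 ^ m) := by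
  set T := (1 + (1 - 2 * η) * d ^ 2) ^ (2 ^ m) with hT
  have hT0 : 0 ≤ T := by
    have : 0 ≤ 1 - 2 * η := by linarith [hη.2]
    positivity
  have hw : ∀ a b : BitString m, 0 ≤ pairProb η a b * (tilt d a * tilt d b) := fun a b =>
    mul_nonneg (pairProb_nonneg hη a b) (mul_pos (tilt_pos hd a) (tilt_pos hd b)).le
  have hc : ∀ c : Fin m → ZMod 2, ∑ a : BitString m, ∑ b : BitString m,
      pairProb η a b * (tilt d a * tilt d b * cappedTilt d M (a + hadamardWord c)) ≤
      -- The extra T at c = 0 is slack that rounds the total to (M + n)T.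
      (if c = 0 then M * T else 0) + T := fun c => by
    split_ifs with h0
    · calc _ ≤ ∑ a : BitString m, ∑ b : BitString m,
            M * (pairProb η a b * (tilt d a * tilt d b)) :=
            Finset.sum_le_sum fun a _ => Finset.sum_le_sum fun b _ => by
              rw [← mul_assoc, mul_comm M]
              exact mul_le_mul_of_nonneg_left (min_le_right _ _) (hw a b)
        _ = M * T := by
            simp only [← Finset.mul_sum]
            rw [sum_pairProb_tilt]
        _ ≤ _ := by linarith
    · rw [zero_add]
      refine le_trans ?_ (sum_pairProb_tilt_shift_le hη hd h0)
      refine Finset.sum_le_sum fun a _ => Finset.sum_le_sum fun b _ => ?_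
      exact (mul_assoc _ _ _).symm.trans_le
        ((mul_le_mul_of_nonneg_left (min_le_left _ _) (hw a b)).trans_eq (mul_assoc _ _ _))
  calc _ = ∑ c, ∑ a : BitString m, ∑ b : BitString m,
        pairProb η a b * (tilt d a * tilt d b * cappedTilt d M (a + hadamardWord c)) := by
        simp only [Finset.mul_sum]
        rw [Finset.sum_congr rfl fun a _ => Finset.sum_comm, Finset.sum_comm]
    _ ≤ ∑ c : Fin m → ZMod 2, ((if c = 0 then M * T else 0) + T) :=
        Finset.sum_le_sum fun c _ => hc c
    _ = (M + 2 ^ m) * T := by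
        rw [Finset.sum_add_distrib, Finset.sum_ite_eq' Finset.univ 0]
        simp
        ring

/-- The success probability of the capped tilted strategy. -/
theorem orbitResponse_score_ge (hη : η ∈ Set.Ioo (0 : ℝ) (1 / 2))
    (hd : d ∈ Set.Ioc (0 : ℝ) (1 / 2)) (hM : 0 < M) (hs : s ∈ Set.Ioc (0 : ℝ) 1) :
    (1 + (1 - 2 * η) * d ^ 2) ^ (2 ^ m) * (1 - 2 * (M / 2 ^ m)) -
      6 * (Real.exp (2 ^ m * d ^ 2 * (s * (1 + s) / 2 + 2 * (1 - 2 * η) + 2 * d)) / M ^ s) ≤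
    2 ^ m * ∑ a : BitString m, ∑ b : BitString m, kvKernel η a b *
      (orbitResponse d M (orbitOf a) a * orbitResponse d M (orbitOf b) b) := by
  set T := (1 + (1 - 2 * η) * d ^ 2) ^ (2 ^ m) with hT
  set W := Real.exp (2 ^ m * d ^ 2 * (s * (1 + s) / 2 + 2 * (1 - 2 * η) + 2 * d)) / M ^ s with hW
  set Z : BitString m → ℝ := fun a => ∑ c, cappedTilt d M (a + hadamardWord c) with hZ
  set I : BitString m → ℝ := fun a => if M < tilt d a then 1 else 0 with hI
  have hn : (0 : ℝ) < 2 ^ m := by positivity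
  have hZ0 : ∀ a, 0 < Z a := orbitSum_pos hd hM
  have hI0 : ∀ a, 0 ≤ I a := fun a => by
    simp only [hI]
    split_ifs <;> norm_num
  have hpt : ∀ a b : BitString m, pairProb η a b * (tilt d a * tilt d b) * 3
      - 3 * (pairProb η a b * (tilt d a * tilt d b * I a))
      - 3 * (pairProb η a b * (tilt d a * tilt d b * I b))
      - pairProb η a b * (tilt d a * tilt d b * Z a) / 2 ^ m
      - pairProb η a b * (tilt d a * tilt d b * Z b) / 2 ^ m ≤
      2 ^ m * (kvKernel η a b *
        (orbitResponse d M (orbitOf a) a * orbitResponse d M (orbitOf b) b)) := fun a b => by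
    have ha := tilt_pos hd a
    have hb := tilt_pos hd b
    have ha' := cappedTilt_pos hd hM a
    have hb' := cappedTilt_pos hd hM b
    have h1 := three_sub_le_one_div_mul (div_pos (hZ0 a) hn) (div_pos (hZ0 b) hn)
    have h2 : cappedTilt d M a * cappedTilt d M b ≤ tilt d a * tilt d b :=
      mul_le_mul (min_le_left _ _) (min_le_left _ _) hb'.le ha.le
    -- If either density exceeds M the left side is at most 0; otherwise the cap is inactive.
    have h3 : tilt d a * tilt d b * (1 - I a - I b) ≤ cappedTilt d M a * cappedTilt d M b := by
      by_cases hA : M < tilt d a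
      · have : I a = 1 := if_pos hA
        rw [this]
        have := mul_nonneg (mul_pos ha hb).le (hI0 b)
        nlinarith [mul_pos ha' hb']
      · by_cases hB : M < tilt d b
        · have : I b = 1 := if_pos hB
          rw [this]
          have := mul_nonneg (mul_pos ha hb).le (hI0 a)
          nlinarith [mul_pos ha' hb']
        · have e1 : cappedTilt d M a = tilt d a := min_eq_left (not_lt.1 hA)
          have e2 : cappedTilt d M b = tilt d b := min_eq_left (not_lt.1 hB)
          rw [e1, e2]
          nlinarith [mul_pos ha hb, mul_nonneg (mul_pos ha hb).le (hI0 a),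
            mul_nonneg (mul_pos ha hb).le (hI0 b)]
    rw [orbitResponse_self, orbitResponse_self, kvKernel_eq]
    change _ ≤ 2 ^ m * (2 ^ m * pairProb η a b * (cappedTilt d M a / Z a * (cappedTilt d M b / Z b)))
    have hZab : 0 ≤ Z a / 2 ^ m + Z b / 2 ^ m :=
      add_nonneg (div_pos (hZ0 a) hn).le (div_pos (hZ0 b) hn).le
    calc _ = pairProb η a b * (3 * (tilt d a * tilt d b * (1 - I a - I b)) -
          tilt d a * tilt d b * (Z a / 2 ^ m + Z b / 2 ^ m)) := by ring
      _ ≤ pairProb η a b * (cappedTilt d M a * cappedTilt d M b *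
          (1 / (Z a / 2 ^ m * (Z b / 2 ^ m)))) := by
          refine mul_le_mul_of_nonneg_left ?_ (pairProb_nonneg hη a b)
          have h4 := mul_le_mul_of_nonneg_left h1 (mul_pos ha' hb').le
          have h5 := mul_le_mul_of_nonneg_right h2 hZab
          linarith
      _ = _ := by
          have := (hZ0 a).ne'
          have := (hZ0 b).ne'
          field_simp
  have hsum := Finset.sum_le_sum fun a (_ : a ∈ Finset.univ) =>
    Finset.sum_le_sum fun b (_ : b ∈ Finset.univ) => hpt a b
  simp only [Finset.sum_sub_distrib, ← Finset.mul_sum, ← Finset.sum_mul, ← Finset.sum_div]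
    at hsum
  have hswap : ∀ F : BitString m → ℝ, ∑ a : BitString m, ∑ b : BitString m,
      pairProb η a b * (tilt d a * tilt d b * F b) = ∑ a : BitString m, ∑ b : BitString m,
      pairProb η a b * (tilt d a * tilt d b * F a) := fun F => by
    rw [Finset.sum_comm]
    exact Finset.sum_congr rfl fun a _ => Finset.sum_congr rfl fun b _ => by
      rw [pairProb_comm, mul_comm (tilt d b)]
  rw [hswap I, hswap Z, sum_pairProb_tilt] at hsum
  have hI' := sum_pairProb_tilt_large_le (m := m) hη hd hM hs
  have hZ' := div_le_div_of_nonneg_right (sum_pairProb_orbitSum_le (m := m) (M := M) hη hd) hn.le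
  have e : (M + 2 ^ m) * T / 2 ^ m = T * (M / 2 ^ m) + T := by
    field_simp
  rw [e] at hZ'
  -- The total is 3T - 6W - 2T(1 + M/n) = T(1 - 2M/n) - 6W.
  linarith

end

/-! ### Asymptotics for the bias η_n. -/

theorem kvBias_add_three (m : ℕ) : kvBias (m + 3) = 1 / 2 - 1 / ((m + 3 : ℕ) : ℝ) := by
  rw [kvBias, Real.logb_pow, Real.logb_self_eq_one (by norm_num), mul_one]

theorem tendsto_two_pow_add_three : Tendsto (fun m : ℕ => 2 ^ (m + 3)) atTop (atTop : Filter ℕ) :=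
  (tendsto_pow_atTop_atTop_of_one_lt one_lt_two).comp (tendsto_add_atTop_nat 3)

theorem tendsto_add_three_cast : Tendsto (fun m : ℕ => ((m + 3 : ℕ) : ℝ)) atTop atTop :=
  tendsto_natCast_atTop_atTop.comp (tendsto_add_atTop_nat 3)

/-- The bias of the tilt that nearly saturates the bound. -/
def tiltBias (ε : ℝ) (n : ℕ) : ℝ := √(2 * (1 - ε) * Real.log 2 * (n / 2 ^ n))

theorem tendsto_tiltBias (ε : ℝ) : Tendsto (fun m : ℕ => tiltBias ε (m + 3)) atTop (𝓝 0) := by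
  have h := (tendsto_pow_const_div_const_pow_of_one_lt 1 one_lt_two).comp (tendsto_add_atTop_nat 3)
  have h2 := (h.const_mul (2 * (1 - ε) * Real.log 2)).sqrt
  simpa [tiltBias, Function.comp_def] using h2

theorem tiltBias_sq {ε : ℝ} (hε : ε < 1) (n : ℕ) :
    2 ^ n * tiltBias ε n ^ 2 = 2 * (1 - ε) * Real.log 2 * n := by
  have : 0 ≤ 1 - ε := by linarith
  have h2 := Real.log_pos one_lt_two
  rw [tiltBias, Real.sq_sqrt (by positivity)]
  field_simp

theorem tiltBias_pos {ε : ℝ} (hε : ε < 1) (m : ℕ) : 0 < tiltBias ε (m + 3) := by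
  have : 0 < 1 - ε := by linarith
  have h2 := Real.log_pos one_lt_two
  exact Real.sqrt_pos.2 (by positivity)

/-- Here 1 - 2η = 2/log₂ n and nd² = 2(1-ε) ln n, whose product is the constant 4(1-ε) ln 2. -/
theorem tendsto_gain {ε : ℝ} (hε : ε < 1) :
    Tendsto (fun m : ℕ => (1 + (1 - 2 * kvBias (m + 3)) * tiltBias ε (m + 3) ^ 2) ^ (2 ^ (m + 3)))
      atTop (𝓝 (Real.exp (4 * (1 - ε) * Real.log 2))) := by
  refine ((Real.tendsto_one_add_div_pow_exp (4 * (1 - ε) * Real.log 2)).comp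
    tendsto_two_pow_add_three).congr fun m => ?_
  have h := tiltBias_sq hε (m + 3)
  have hm : ((m + 3 : ℕ) : ℝ) ≠ 0 := by positivity
  simp only [Function.comp_apply]
  congr 2
  rw [kvBias_add_three]
  push_cast at h hm ⊢
  rw [div_eq_iff (by positivity), mul_assoc (1 - _), mul_comm (tiltBias _ _ ^ 2), h]
  field_simp
  ring

theorem tendsto_cap {ε : ℝ} (hε : 0 < ε) :
    Tendsto (fun m : ℕ => (2 : ℝ) ^ ((1 - ε / 4) * ((m + 3 : ℕ) : ℝ)) / 2 ^ (m + 3))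
      atTop (𝓝 0) := by
  have h : Tendsto (fun m : ℕ => Real.exp (-(ε / 4 * Real.log 2 * ((m + 3 : ℕ) : ℝ))))
      atTop (𝓝 0) :=
    Real.tendsto_exp_neg_atTop_nhds_zero.comp
      (tendsto_add_three_cast.const_mul_atTop (by positivity [Real.log_pos one_lt_two]))
  refine h.congr fun m => ?_
  rw [← Real.rpow_natCast 2 (m + 3), ← Real.rpow_sub two_pos, Real.rpow_def_of_pos two_pos]
  congr 1
  ring

/-- Under the tilted law the density is typically about e^(nd²/2) = n^(1-ε), below the cap M =
n^(1-ε/4). With s = ε/2 the Chernoff bound decays like n^(-(ε²/8 + ε³/4)), up to a bounded factor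
from the noise correlation and an n^(o(1)) factor from d → 0. -/
theorem tendsto_tail {ε : ℝ} (hε0 : 0 < ε) (hε1 : ε < 1) :
    Tendsto (fun m : ℕ => Real.exp (2 ^ (m + 3) * tiltBias ε (m + 3) ^ 2 *
      (ε / 2 * (1 + ε / 2) / 2 + 2 * (1 - 2 * kvBias (m + 3)) + 2 * tiltBias ε (m + 3))) /
      ((2 : ℝ) ^ ((1 - ε / 4) * ((m + 3 : ℕ) : ℝ))) ^ (ε / 2)) atTop (𝓝 0) := by
  have hl := Real.log_pos one_lt_two
  have h1 : Tendsto (fun m : ℕ => Real.log 2 * (ε ^ 2 / 8 + ε ^ 3 / 4 - 4 * (1 - ε) * tiltBias ε (m + 3)))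
      atTop (𝓝 (Real.log 2 * (ε ^ 2 / 8 + ε ^ 3 / 4 - 4 * (1 - ε) * 0))) :=
    (((tendsto_tiltBias ε).const_mul _).const_sub _).const_mul _
  have h2 := (h1.pos_mul_atTop (by simp; positivity) tendsto_add_three_cast)
  have h3 := Real.tendsto_exp_neg_atTop_nhds_zero.comp
    (tendsto_atTop_add_const_right _ (-(8 * (1 - ε) * Real.log 2)) h2)
  refine h3.congr fun m => ?_
  have hm : ((m + 3 : ℕ) : ℝ) ≠ 0 := by positivity
  simp only [Function.comp_apply]
  rw [tiltBias_sq hε1, kvBias_add_three, ← Real.rpow_mul zero_le_two,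
    Real.rpow_def_of_pos two_pos, ← Real.exp_sub]
  congr 1
  generalize ((m + 3 : ℕ) : ℝ) = n at *
  field_simp
  ring

/-- With N = log₂ n, 1 - η/(1-η) = 4/(N + 2), so the quantity is 2^(4N/(N+2)) and tends to 16. -/
theorem tendsto_two_pow_mul_bound :
    Tendsto (fun m : ℕ => (2 : ℝ) ^ (m + 3) *
      ((2 : ℝ) ^ (m + 3)) ^ (-(kvBias (m + 3) / (1 - kvBias (m + 3))))) atTop
      (𝓝 (Real.exp (4 * Real.log 2))) := by
  have h : Tendsto (fun m : ℕ => Real.exp ((4 - 8 / (((m + 3 : ℕ) : ℝ) + 2)) * Real.log 2)) atTop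
      (𝓝 (Real.exp ((4 - 0) * Real.log 2))) := by
    refine (Real.continuous_exp.tendsto _).comp (Tendsto.mul_const _ (Tendsto.const_sub _ ?_))
    exact Tendsto.const_div_atTop (tendsto_atTop_add_const_right _ _ tendsto_add_three_cast) _
  rw [sub_zero] at h
  refine h.congr fun m => ?_
  have hm : (0 : ℝ) < ((m + 3 : ℕ) : ℝ) := by positivity
  rw [kvBias_add_three, ← Real.rpow_natCast 2 (m + 3), ← Real.rpow_mul zero_le_two,
    ← Real.rpow_add two_pos, Real.rpow_def_of_pos two_pos]
  congr 1
  generalize ((m + 3 : ℕ) : ℝ) = n at *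
  have h2 : 1 - (1 / 2 - 1 / n) = (n + 2) / (2 * n) := by
    field_simp
    ring
  rw [h2]
  field_simp
  ring

/-- For every `r < 1` there is, for large `n`, a response function whose success probability
is at least `r` times the upper bound. -/
theorem eventually_exists_response {r : ℝ} (hr : r < 1) :
    ∀ᶠ m : ℕ in atTop, ∃ R : Orbit (m + 3) → BitString (m + 3) → ℝ,
      (∀ u a, 0 ≤ R u a) ∧ (∀ u, ∑ a, R u a = 1) ∧
      r * ((2 : ℝ) ^ (m + 3)) ^ (-(kvBias (m + 3) / (1 - kvBias (m + 3)))) <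
      ∑ a, ∑ b, kvKernel (kvBias (m + 3)) a b * (R (orbitOf a) a * R (orbitOf b) b) := by
  have hl := Real.log_pos one_lt_two
  -- As r < 1, continuity at ε = 0 gives ε > 0 with 16r < 16^(1-ε).
  obtain ⟨ε, hεr, hε0, hε1⟩ : ∃ ε : ℝ, r * Real.exp (4 * Real.log 2) <
      Real.exp (4 * (1 - ε) * Real.log 2) ∧ 0 < ε ∧ ε < 1 := by
    have hc : Tendsto (fun ε : ℝ => Real.exp (4 * (1 - ε) * Real.log 2)) (𝓝 0)
        (𝓝 (Real.exp (4 * (1 - 0) * Real.log 2))) :=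
      Continuous.tendsto (by fun_prop) 0
    have hlt : r * Real.exp (4 * Real.log 2) < Real.exp (4 * (1 - 0) * Real.log 2) := by
      rw [sub_zero, mul_one]
      exact mul_lt_of_lt_one_left (Real.exp_pos _) hr
    obtain ⟨ε, h1, h2⟩ := (((hc.eventually_const_lt hlt).filter_mono nhdsWithin_le_nhds).and
      (Ioo_mem_nhdsGT one_pos)).exists
    exact ⟨ε, h1, h2⟩
  have hlow := ((tendsto_gain hε1).mul (((tendsto_cap hε0).const_mul 2).const_sub 1)).sub
    ((tendsto_tail hε0 hε1).const_mul 6)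
  have hup := tendsto_two_pow_mul_bound.const_mul r
  filter_upwards [hup.eventually_lt hlow (by simpa using hεr),
    (tendsto_tiltBias ε).eventually_lt_const (show (0 : ℝ) < 1 / 2 by norm_num)] with m hm hd
  have hd' : tiltBias ε (m + 3) ∈ Set.Ioc (0 : ℝ) (1 / 2) := ⟨tiltBias_pos hε1 m, hd.le⟩
  have hM : (0 : ℝ) < 2 ^ ((1 - ε / 4) * ((m + 3 : ℕ) : ℝ)) := by positivity
  refine ⟨_, orbitResponse_nonneg hd' hM, sum_orbitResponse hd' hM, ?_⟩
  have h := hm.trans_le (orbitResponse_score_ge (kvBias_mem m) hd' hM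
    (s := ε / 2) ⟨by linarith, by linarith⟩)
  rw [mul_left_comm] at h
  exact lt_of_mul_lt_mul_left h (by positivity)

/-! ### The limits. -/

theorem tendsto_one_of_eventually {f : ℕ → ℝ} (hf : ∀ m, f m ≤ 1)
    (h : ∀ r < 1, ∀ᶠ m in atTop, r < f m) : Tendsto f atTop (𝓝 1) :=
  tendsto_order.2 ⟨h, fun _ hr => Eventually.of_forall fun m => (hf m).trans_lt hr⟩

theorem tendsto_localBound_div :
    Tendsto (fun m : ℕ => (kvGame (m + 3) (kvBias (m + 3)) (kvBias_mem m)).localBound /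
      ((2 : ℝ) ^ (m + 3)) ^ (-(kvBias (m + 3) / (1 - kvBias (m + 3))))) atTop (𝓝 1) := by
  refine tendsto_one_of_eventually (fun m => ?_) fun r hr => ?_
  · exact div_le_one_of_le₀ (kvGame_localBound_le _ _ _) (by positivity)
  · filter_upwards [eventually_exists_response hr] with m ⟨R, hR, hR1, h⟩
    rw [lt_div_iff₀ (by positivity)]
    exact h.trans_le ((isFiberGame_kvGame _ _ (kvBias_mem m)).le_localBound hR hR1)

theorem tendsto_repetition_localBound_div (k : ℕ) :
    Tendsto (fun m : ℕ =>
      ((kvGame (m + 3) (kvBias (m + 3)) (kvBias_mem m)).repetition k).localBound /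
        ((2 : ℝ) ^ (m + 3)) ^ (-((k : ℝ) * kvBias (m + 3) / (1 - kvBias (m + 3)))))
      atTop (𝓝 1) := by
  refine tendsto_one_of_eventually (fun m => ?_) fun r hr => ?_
  · exact div_le_one_of_le₀ (kvGame_repetition_localBound_le _ _ _ _) (by positivity)
  · have hc : Tendsto (fun t : ℝ => t ^ k) (𝓝 1) (𝓝 (1 ^ k)) := (continuous_pow k).tendsto 1
    obtain ⟨t, h1, h0, ht1⟩ := (((hc.eventually_const_lt (by rwa [one_pow])).filter_mono
      nhdsWithin_le_nhds).and (Ioo_mem_nhdsLT (zero_lt_one (α := ℝ)))).exists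
    filter_upwards [eventually_exists_response ht1] with m ⟨R, hR, hR1, h⟩
    rw [lt_div_iff₀ (by positivity), rpow_neg_mul_div_eq_pow]
    refine (mul_lt_mul_of_pos_right h1 (by positivity)).trans_le ?_
    rw [← mul_pow]
    exact (pow_le_pow_left₀ (by positivity) h.le k).trans
      ((isFiberGame_kvGame _ _ (kvBias_mem m)).pow_le_localBound_repetition hR hR1 k)

end

theorem mainTheorem3 :
    (∀ (m : ℕ) (η : ℝ) (hη : η ∈ Set.Ioo (0 : ℝ) (1 / 2)),
      (kvGame m η hη).localBound ≤ ((2 : ℝ) ^ m) ^ (-(η / (1 - η))) ∧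
      ∀ k : ℕ, ((kvGame m η hη).repetition k).localBound
        ≤ ((2 : ℝ) ^ m) ^ (-((k : ℝ) * η / (1 - η)))) ∧
    Tendsto (fun m : ℕ => (kvGame (m + 3) (kvBias (m + 3)) (kvBias_mem m)).localBound /
      ((2 : ℝ) ^ (m + 3)) ^ (-(kvBias (m + 3) / (1 - kvBias (m + 3))))) atTop (𝓝 1) ∧
    (∀ k : ℕ, Tendsto (fun m : ℕ =>
      ((kvGame (m + 3) (kvBias (m + 3)) (kvBias_mem m)).repetition k).localBound /
        ((2 : ℝ) ^ (m + 3)) ^ (-((k : ℝ) * kvBias (m + 3) / (1 - kvBias (m + 3)))))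
      atTop (𝓝 1)) ∧
    (∀ k : ℕ, Tendsto (fun m : ℕ =>
      ((kvGame (m + 3) (kvBias (m + 3)) (kvBias_mem m)).repetition k).localBound /
        (kvGame (m + 3) (kvBias (m + 3)) (kvBias_mem m)).localBound ^ k)
      atTop (𝓝 1)) := by

  refine ⟨fun m η hη => ⟨kvGame_localBound_le m η hη, kvGame_repetition_localBound_le m η hη⟩,
    tendsto_localBound_div, tendsto_repetition_localBound_div, fun k => ?_⟩
  -- The normalization of the repeated game is exactly the k-th power of that of the single game, so
  -- it cancels in the quotient.
  have h := (tendsto_repetition_localBound_div k).div (tendsto_localBound_div.pow k)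
    (by norm_num)
  rw [one_pow, div_one] at h
  refine h.congr fun m => ?_
  have hB : (0 : ℝ) < ((2 : ℝ) ^ (m + 3)) ^ (-(kvBias (m + 3) / (1 - kvBias (m + 3)))) := by
    positivity
  simp only [Pi.div_apply]
  rw [rpow_neg_mul_div_eq_pow, div_pow, div_div_div_cancel_right₀ (pow_pos hB k).ne']
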